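/- Let $d\ge 1$ and $1\le p<\infty$. For a nonnegative kernel $\rho\in L^1_{loc}(\mathbb{R}^d)$, a set $\Omega\subset\mathbb{R}^d$ and a vector field ${\bf u}:\Omega\to\mathbb{R}^d$ put $$|{\bf u}|_{\mathcal S_{\rho,p}(\Omega)}=\left(\int_\Omega\int_\Omega \rho({\bf y}-{\bf x})\left|\frac{{\bf u}({\bf y})-{\bf u}({\bf x})}{|{\bf y}-{\bf x}|}\cdot\frac{{\bf y}-{\bf x}}{|{\bf y}-{\bf x}|}\right|^p d{\bf y}\,d{\bf x}\right)^{1/p}\in[0,\infty],$$ and let $\mathcal S_{\rho,p}(\Omega)$ be the space of all ${\bf u}\in L^p(\Omega;\mathbb{R}^d)$ with $|{\bf u}|_{\mathcal S_{\rho,p}(\Omega)}<\infty$. Let $\rho\in L^1_{loc}(\mathbb{R}^d)$ be nonnegative and radial, with $|\xi|^{-p}\rho(\xi)$ nonincreasing in $|\xi|$, and suppose that $\int_{B_\delta}\rho>0$ for all $\delta>0$ and $$\lim_{\delta\to0^+}\frac{\delta^p}{\int_{B_\delta}\rho(\xi)\,d\xi}=0,$$ where $B_\delta$ is the ball of radius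 $\delta$ centred at the origin. Let $\rho_n\in L^1_{loc}(\mathbb{R}^d)$, $n\ge1$, be nonnegative and radial, with $|\xi|^{-p}\rho_n(\xi)$ nonincreasing in $|\xi|$, and suppose that $\rho_n\rightharpoonup\rho$ weakly in $L^1_{loc}(\mathbb{R}^d)$, that is, $\int\rho_n g\to\int\rho g$ for every bounded measurable function $g$ with compact support (this holds in particular if $\rho_n\rightharpoonup\rho$ weakly in $L^1(\mathbb{R}^d)$). Let ${\bf u}_n\in L^p(\mathbb{R}^d;\mathbb{R}^d)$ satisfy $$\sup_{n\ge1}\left\{\|{\bf u}_n\|_{L^p(\mathbb{R}^d)}+|{\bf u}_n|_{\mathcal S_{\rho_n,p}(\mathbb{R}^d)}\right\}<\infty.$$ Then $\{{\bf u}_n\}$ is precompact in $L^p_{loc}(\mathbb{R}^d;\mathbb{R}^d)$: every subsequence has a further subsequence that converges, in $L^p$ on every compact set, to some ${\bf u}\in L^p_{loc}(\mathbb{R}^d;\mathbb{R}^d)$. Moreover, if $A\subset\mathbb{R}^d$ is bounded, then every limit point in $L^p(A;\mathbb{R}^d)$ of the sequence of restrictions $\{{\bf u}_n|_A\}$ (that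 is, every limit of a subsequence) belongs to $\mathcal S_{\rho,p}(A)$. -/

import Mathlib

open MeasureTheory Filter Topology
open scoped ENNReal

namespace NonlocalSpace

variable {d : ℕ}

/-- Radiality together with the monotonicity of `|ξ|⁻ᵖ ρ(ξ)`: the kernel `ρ` depends only on `|ξ|`,
and `|ξ|⁻ᵖ ρ(ξ)` is nonincreasing in `|ξ| ∈ (0, ∞)`. -/
def RadialMonotone (p : ℝ) (ρ : EuclideanSpace ℝ (Fin d) → ℝ) : Prop :=
  (∀ ξ η : EuclideanSpace ℝ (Fin d), ‖ξ‖ = ‖η‖ → ρ ξ = ρ η) ∧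
  ∀ ξ η : EuclideanSpace ℝ (Fin d), 0 < ‖ξ‖ → ‖ξ‖ ≤ ‖η‖ →
    ‖η‖ ^ (-p) * ρ η ≤ ‖ξ‖ ^ (-p) * ρ ξ

/-- `δᵖ / ∫_{B_δ} ρ → 0` as `δ → 0⁺`. The quotient is taken in `[0, ∞]`, where `a / 0 = ∞` for
`a > 0`, so a kernel that vanishes near the origin does not satisfy the condition. -/
def SufficientlySingular (p : ℝ) (ρ : EuclideanSpace ℝ (Fin d) → ℝ) : Prop :=
  Tendsto (fun δ : ℝ => ENNReal.ofReal (δ ^ p) /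
      ∫⁻ ξ in Metric.ball (0 : EuclideanSpace ℝ (Fin d)) δ, ENNReal.ofReal (ρ ξ))
    (𝓝[>] 0) (𝓝 0)

/-- Weak convergence in `L¹_loc(ℝᵈ)`: convergence of the integrals against every bounded
measurable function with compact support. Weak convergence in `L¹(ℝᵈ)` implies it. -/
def WeakTendstoL1Loc (ρn : ℕ → EuclideanSpace ℝ (Fin d) → ℝ)
    (ρ : EuclideanSpace ℝ (Fin d) → ℝ) : Prop :=
  ∀ g : EuclideanSpace ℝ (Fin d) → ℝ, Measurable g → (∃ C : ℝ, ∀ ξ, |g ξ| ≤ C) →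
    HasCompactSupport g →
    Tendsto (fun n => ∫ ξ, ρn n ξ * g ξ) atTop (𝓝 (∫ ξ, ρ ξ * g ξ))

/-- The projected difference quotient
`(u(y) - u(x)) / |y - x| · (y - x) / |y - x|`. -/
noncomputable def projDiffQuot (u : EuclideanSpace ℝ (Fin d) → EuclideanSpace ℝ (Fin d))
    (x y : EuclideanSpace ℝ (Fin d)) : ℝ :=
  inner ℝ (‖y - x‖⁻¹ • (u y - u x)) (‖y - x‖⁻¹ • (y - x))

/-- The seminorm `|u|_{S_{ρ,p}(Ω)}`, with values in `[0, ∞]`: the `p`-th root of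
`∫_Ω ∫_Ω ρ(y - x) |D(u)(x, y)|ᵖ dy dx`. -/
noncomputable def seminorm (ρ : EuclideanSpace ℝ (Fin d) → ℝ) (p : ℝ)
    (Ω : Set (EuclideanSpace ℝ (Fin d)))
    (u : EuclideanSpace ℝ (Fin d) → EuclideanSpace ℝ (Fin d)) : ℝ≥0∞ :=
  (∫⁻ x in Ω, ∫⁻ y in Ω, ENNReal.ofReal (ρ (y - x)) * ENNReal.ofReal (|projDiffQuot u x y| ^ p)) ^
    (1 / p)

/-- The space `S_{ρ,p}(Ω)`, as a set of representatives: the fields in `Lᵖ(Ω; ℝᵈ)` with finite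
seminorm. -/
def space (ρ : EuclideanSpace ℝ (Fin d) → ℝ) (p : ℝ) (Ω : Set (EuclideanSpace ℝ (Fin d))) :
    Set (EuclideanSpace ℝ (Fin d) → EuclideanSpace ℝ (Fin d)) :=
  {u | MemLp u (ENNReal.ofReal p) (volume.restrict Ω) ∧ seminorm ρ p Ω u < ∞}

/-- `uₙ → v` in `Lᵖ(A; ℝᵈ)`. -/
def TendstoLp (p : ℝ) (A : Set (EuclideanSpace ℝ (Fin d)))
    (u : ℕ → EuclideanSpace ℝ (Fin d) → EuclideanSpace ℝ (Fin d))
    (v : EuclideanSpace ℝ (Fin d) → EuclideanSpace ℝ (Fin d)) : Prop :=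
  Tendsto (fun n => eLpNorm (u n - v) (ENNReal.ofReal p) (volume.restrict A)) atTop (𝓝 0)

/-- The sequence `u` is precompact in `Lᵖ_loc(ℝᵈ; ℝᵈ)`: every subsequence has a further subsequence
that converges, in `Lᵖ` on every compact set, to a field in `Lᵖ_loc(ℝᵈ; ℝᵈ)`. -/
def PrecompactLpLoc (p : ℝ)
    (u : ℕ → EuclideanSpace ℝ (Fin d) → EuclideanSpace ℝ (Fin d)) : Prop :=
  ∀ φ : ℕ → ℕ, StrictMono φ → ∃ ψ : ℕ → ℕ, StrictMono ψ ∧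
    ∃ v : EuclideanSpace ℝ (Fin d) → EuclideanSpace ℝ (Fin d),
      ∀ K : Set (EuclideanSpace ℝ (Fin d)), IsCompact K →
        MemLp v (ENNReal.ofReal p) (volume.restrict K) ∧
        TendstoLp p K (fun j => u (φ (ψ j))) v

/-- `v` is a limit point in `Lᵖ(A; ℝᵈ)` of the sequence of restrictions of `uₙ` to `A`: a field in
`Lᵖ(A; ℝᵈ)` that is the limit of a subsequence. -/
def IsLimitPointLp (p : ℝ) (A : Set (EuclideanSpace ℝ (Fin d)))
    (u : ℕ → EuclideanSpace ℝ (Fin d) → EuclideanSpace ℝ (Fin d))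
    (v : EuclideanSpace ℝ (Fin d) → EuclideanSpace ℝ (Fin d)) : Prop :=
  MemLp v (ENNReal.ofReal p) (volume.restrict A) ∧
    ∃ φ : ℕ → ℕ, StrictMono φ ∧ TendstoLp p A (fun j => u (φ j)) v

end NonlocalSpace

/-! The energy sees only the component of `u (x + z) - u x` along `z`. The proof averages `u`
against the matrix kernel `K(z) = w(z) ẑ ⊗ ẑ`, where `ẑ = z / |z|` and `w` is `ρ` cut off to the
ball `B_δ`. Since `w` is radial, `∫ K = c · Id` with `c = W / d` and `W = ∫_{B_δ} ρ`
(`integral_projKernel_apply`). Hence `∫ K(z) u(x + z) dz - c u(x)` is the integral of `w(z) (ẑ ·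
(u(x + z) - u(x))) ẑ`, which involves only what the energy sees. If the energy were built on `ρ`,
Jensen's inequality would bound its `Lᵖ` norm by `W^(1 - 1/p) δ` times the seminorm; dividing by `c`
leaves `d (δᵖ / W)^(1/p)` times the seminorm, which is small for suitable `δ` by
`SufficientlySingular`.

The energy of `uₙ` is built on `ρₙ`, so `w` is split as `min(ρₙ, w) + (w - ρₙ)⁺`. The first part is
controlled by the energy as above, the second by its mass times `2 ‖uₙ‖_p`. That mass tends to `0`
by dominated convergence, because `liminf ρₙ ≥ ρ` almost everywhere
(`WeakTendstoL1Loc.ae_eventually_lt`): weak convergence tested on thin shells, together with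
monotonicity of `|ξ|⁻ᵖ ρₙ`, gives a pointwise bound at each radius where `|ξ|⁻ᵖ ρ` is continuous.

So for each `ε`, `uₙ` is eventually `ε`-close in `Lᵖ` to `c⁻¹ K ∗ uₙ` (`exists_kernel_approx`). An
operator with integrable kernel maps bounded sequences to locally totally bounded ones
(`totBddLp_kernelOp`), so `uₙ` is totally bounded on balls and `exists_subseq_tendsto` gives
compactness. For limit points, a subsequence converges almost everywhere, and Fatou's lemma with
`liminf ρₙ ≥ ρ` bounds the limiting energy. -/

namespace NonlocalSpace

/-! ### Weighted Jensen and Minkowski-type inequalities -/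

section Young

variable {α β : Type*} [MeasurableSpace α] [MeasurableSpace β] {μ : Measure α} {ν : Measure β}

/-- Jensen's inequality for the weight `k`. -/
theorem rpow_lintegral_mul_le {p : ℝ} (hp : 1 ≤ p) {k f : α → ℝ≥0∞} (hk : AEMeasurable k μ)
    (hf : AEMeasurable f μ) :
    (∫⁻ x, k x * f x ∂μ) ^ p ≤ (∫⁻ x, k x ∂μ) ^ (p - 1) * ∫⁻ x, k x * f x ^ p ∂μ := by
  -- For `p = 1` there is no finite conjugate exponent, and both sides agree.
  rcases hp.eq_or_lt with rfl | hp
  · simp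
  have h0 : 0 < p := by linarith
  have hpq : p.HolderConjugate p.conjExponent := Real.HolderConjugate.conjExponent hp
  have hq0 : 0 < p.conjExponent := hpq.symm.pos
  -- Hölder for the factorisation `k f = (k^(1/p) f) · k^(1/q)`.
  have h := ENNReal.lintegral_mul_le_Lp_mul_Lq μ hpq (f := fun x => k x ^ (1 / p) * f x)
    (g := fun x => k x ^ (1 / p.conjExponent)) ((hk.pow_const _).mul hf) (hk.pow_const _)
  have e1 : ∀ x, ((fun x => k x ^ (1 / p) * f x) * fun x => k x ^ (1 / p.conjExponent)) x
      = k x * f x := by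
    intro x
    simp only [Pi.mul_apply]
    rw [mul_right_comm, ← ENNReal.rpow_add_of_nonneg _ _ (by positivity) (by positivity)]
    simp [hpq.inv_add_inv_eq_one]
  have e2 : ∀ x, (k x ^ (1 / p) * f x) ^ p = k x * f x ^ p := by
    intro x
    rw [ENNReal.mul_rpow_of_nonneg _ _ h0.le, ← ENNReal.rpow_mul]
    simp [h0.ne']
  have e3 : ∀ x, (k x ^ (1 / p.conjExponent)) ^ p.conjExponent = k x := by
    intro x
    rw [← ENNReal.rpow_mul]
    simp [hq0.ne']
  simp only [e1, e2, e3] at h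
  calc (∫⁻ x, k x * f x ∂μ) ^ p ≤ _ := ENNReal.rpow_le_rpow h h0.le
    _ = _ := by
      rw [ENNReal.mul_rpow_of_nonneg _ _ h0.le, ← ENNReal.rpow_mul, ← ENNReal.rpow_mul, mul_comm]
      congr 2
      · have := hpq.sub_one_mul_conj
        field_simp
        linarith
      · simp [h0.ne']

variable [SFinite μ] [SFinite ν]

theorem lintegral_rpow_lintegral_mul_le {p : ℝ} (hp : 1 ≤ p) {k : β → ℝ≥0∞} {F : α → β → ℝ≥0∞}
    (hk : AEMeasurable k ν) (hF : Measurable (Function.uncurry F)) :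
    ∫⁻ x, (∫⁻ z, k z * F x z ∂ν) ^ p ∂μ
      ≤ (∫⁻ z, k z ∂ν) ^ (p - 1) * ∫⁻ z, k z * ∫⁻ x, F x z ^ p ∂μ ∂ν := by
  have hm : AEMeasurable (Function.uncurry fun x z => k z * F x z ^ p) (μ.prod ν) :=
    hk.comp_snd.mul (hF.pow_const p).aemeasurable
  calc ∫⁻ x, (∫⁻ z, k z * F x z ∂ν) ^ p ∂μ
      ≤ ∫⁻ x, (∫⁻ z, k z ∂ν) ^ (p - 1) * ∫⁻ z, k z * F x z ^ p ∂ν ∂μ :=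
        lintegral_mono fun x => rpow_lintegral_mul_le hp hk (hF.of_uncurry_left).aemeasurable
    _ = (∫⁻ z, k z ∂ν) ^ (p - 1) * ∫⁻ x, ∫⁻ z, k z * F x z ^ p ∂ν ∂μ :=
        lintegral_const_mul'' _ hm.lintegral_prod_right'
    _ = _ := by
      rw [lintegral_lintegral_swap hm]
      congr 1
      refine lintegral_congr fun z => ?_
      rw [lintegral_const_mul _ ((hF.of_uncurry_right).pow_const p)]

theorem eLpNorm_lintegral_mul_le {p : ℝ} (hp : 1 ≤ p) {k : β → ℝ≥0∞} {F : α → β → ℝ≥0∞}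
    (hk : AEMeasurable k ν) (hF : Measurable (Function.uncurry F)) :
    eLpNorm (fun x => ∫⁻ z, k z * F x z ∂ν) (ENNReal.ofReal p) μ
      ≤ (∫⁻ z, k z ∂ν) ^ (1 - 1 / p) * (∫⁻ z, k z * ∫⁻ x, F x z ^ p ∂μ ∂ν) ^ (1 / p) := by
  have h0 : 0 < p := by linarith
  rw [eLpNorm_eq_lintegral_rpow_enorm_toReal (by simpa using h0) (by simp),
    ENNReal.toReal_ofReal h0.le]
  simp only [enorm_eq_self]
  refine (ENNReal.rpow_le_rpow (lintegral_rpow_lintegral_mul_le hp hk hF) (by positivity)).trans ?_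
  rw [ENNReal.mul_rpow_of_nonneg _ _ (by positivity), ← ENNReal.rpow_mul]
  apply le_of_eq
  congr 2
  field_simp

end Young

/-! ### Convolution with matrix-valued kernels -/

section Convolution

variable {E : Type*} [NormedAddCommGroup E] [InnerProductSpace ℝ E] [FiniteDimensional ℝ E]
  [MeasurableSpace E] [BorelSpace E]


/-- Young's inequality for nonnegative functions. -/
theorem eLpNorm_lintegral_mul_translate_le {p : ℝ} (hp : 1 ≤ p) {k f : E → ℝ≥0∞}
    (hk : AEMeasurable k volume) (hf : Measurable f) :
    eLpNorm (fun x => ∫⁻ z, k z * f (x + z)) (ENNReal.ofReal p) volume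
      ≤ (∫⁻ z, k z) * eLpNorm f (ENNReal.ofReal p) volume := by
  have h0 : 0 < p := by linarith
  refine (eLpNorm_lintegral_mul_le hp hk (F := fun x z => f (x + z)) (by
    exact hf.comp measurable_add)).trans ?_
  have e : ∀ z, ∫⁻ x, f (x + z) ^ p = ∫⁻ x, f x ^ p :=
    fun z => lintegral_add_right_eq_self (fun x => f x ^ p) z
  simp only [e]
  rw [lintegral_mul_const'' _ hk, eLpNorm_eq_lintegral_rpow_enorm_toReal (by simpa using h0)
    (by simp), ENNReal.toReal_ofReal h0.le, ENNReal.mul_rpow_of_nonneg _ _ (by positivity),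
    ← mul_assoc, ← ENNReal.rpow_add_of_nonneg _ _ (by
      rw [sub_nonneg, div_le_one h0]; exact hp) (by positivity)]
  simp

/-- The operator `u ↦ ∫ K(z) u(· + z) dz` with matrix-valued kernel `K`. -/
noncomputable def kernelOp (K : E → E →L[ℝ] E) (u : E → E) (x : E) : E := ∫ z, K z (u (x + z))

variable {K : E → E →L[ℝ] E} {u : E → E} {p : ℝ}

theorem enorm_kernelOp_le (x : E) : ‖kernelOp K u x‖ₑ ≤ ∫⁻ z, ‖K z‖ₑ * ‖u (x + z)‖ₑ :=
  (enorm_integral_le_lintegral_enorm _).trans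
    (lintegral_mono fun z => ContinuousLinearMap.le_opENorm (K z) _)

theorem eLpNorm_kernelOp_le (hp : 1 ≤ p) (hK : Integrable K volume) (hu : Measurable u) :
    eLpNorm (kernelOp K u) (ENNReal.ofReal p) volume
      ≤ (∫⁻ z, ‖K z‖ₑ) * eLpNorm u (ENNReal.ofReal p) volume := by
  have h1 := eLpNorm_lintegral_mul_translate_le hp hK.1.enorm hu.enorm
  rw [show eLpNorm (fun x => ‖u x‖ₑ) (ENNReal.ofReal p) volume = eLpNorm u (ENNReal.ofReal p) volume
    from eLpNorm_enorm u] at h1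
  refine le_trans (eLpNorm_mono_enorm fun x => ?_) h1
  rw [enorm_eq_self]
  exact enorm_kernelOp_le x

theorem aestronglyMeasurable_kernel_apply (hK : AEStronglyMeasurable K volume)
    (hu : Measurable u) :
    AEStronglyMeasurable (fun q : E × E => K q.2 (u (q.1 + q.2))) (volume.prod volume) :=
  (ContinuousLinearMap.apply ℝ E).flip.aestronglyMeasurable_comp₂ hK.comp_snd
    (hu.comp measurable_add).stronglyMeasurable.aestronglyMeasurable

theorem aestronglyMeasurable_kernelOp (hK : AEStronglyMeasurable K volume) (hu : Measurable u) :
    AEStronglyMeasurable (kernelOp K u) volume :=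
  (aestronglyMeasurable_kernel_apply hK hu).integral_prod_right'

theorem memLp_kernelOp (hp : 1 ≤ p) (hK : Integrable K volume) (hu : Measurable u)
    (hup : MemLp u (ENNReal.ofReal p) volume) :
    MemLp (kernelOp K u) (ENNReal.ofReal p) volume :=
  ⟨aestronglyMeasurable_kernelOp hK.1 hu,
    (eLpNorm_kernelOp_le hp hK hu).trans_lt (ENNReal.mul_lt_top hK.2 hup.2)⟩

/-- The Bochner integral in `kernelOp` is `0` where the integrand is not integrable, so linearity in
the kernel needs this. It holds because Young's inequality makes the integral of norms an `Lᵖ`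
function of `x`, hence finite almost everywhere. -/
theorem ae_integrable_kernel_apply (hp : 1 ≤ p) (hK : Integrable K volume) (hu : Measurable u)
    (hup : MemLp u (ENNReal.ofReal p) volume) :
    ∀ᵐ x, Integrable (fun z => K z (u (x + z))) volume := by
  have h0 : 0 < p := by linarith
  have h1 := eLpNorm_lintegral_mul_translate_le hp hK.1.enorm hu.enorm
  rw [show eLpNorm (fun x => ‖u x‖ₑ) (ENNReal.ofReal p) volume = eLpNorm u (ENNReal.ofReal p) volume
    from eLpNorm_enorm u] at h1
  have h2 := h1.trans_lt (ENNReal.mul_lt_top hK.2 hup.2)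
  rw [eLpNorm_lt_top_iff_lintegral_rpow_enorm_lt_top (by simpa using h0) (by simp),
    ENNReal.toReal_ofReal h0.le] at h2
  have hm : AEMeasurable (fun x : E => ∫⁻ z, ‖K z‖ₑ * ‖u (x + z)‖ₑ) volume :=
    AEMeasurable.lintegral_prod_right' (f := fun q : E × E => ‖K q.2‖ₑ * ‖u (q.1 + q.2)‖ₑ)
      (hK.1.enorm.comp_snd.mul (hu.comp measurable_add).enorm.aemeasurable)
  simp only [enorm_eq_self] at h2
  filter_upwards [ae_lt_top' (hm.pow_const p) h2.ne] with x hx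
  refine ⟨?_, ?_⟩
  · exact (ContinuousLinearMap.apply ℝ E).flip.aestronglyMeasurable_comp₂ hK.1
      (hu.comp (measurable_const_add x)).stronglyMeasurable.aestronglyMeasurable
  · refine (lintegral_mono fun z => ContinuousLinearMap.le_opENorm (K z) _).trans_lt ?_
    exact (ENNReal.rpow_lt_top_iff_of_pos h0).1 hx

theorem kernelOp_sub_ae (hp : 1 ≤ p) {K' : E → E →L[ℝ] E} (hK : Integrable K volume)
    (hK' : Integrable K' volume) (hu : Measurable u)
    (hup : MemLp u (ENNReal.ofReal p) volume) :
    kernelOp K u - kernelOp K' u =ᵐ[volume] kernelOp (K - K') u := by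
  filter_upwards [ae_integrable_kernel_apply hp hK hu hup,
    ae_integrable_kernel_apply hp hK' hu hup] with x hx hx'
  simp only [Pi.sub_apply, kernelOp, sub_apply]
  rw [integral_sub hx hx']

end Convolution

/-! ### Local total boundedness and extraction of subsequences -/

section TotallyBounded

set_option linter.unusedSectionVars false

variable {E : Type*} [NormedAddCommGroup E] [InnerProductSpace ℝ E] [FiniteDimensional ℝ E]
  [MeasurableSpace E] [BorelSpace E]

/-- Total boundedness of a sequence of functions in `Lᵖ(μ)`. -/
def TotBddLp (P : ℝ≥0∞) (μ : Measure E) (f : ℕ → E → E) : Prop :=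
  ∀ ε : ℝ≥0∞, 0 < ε → ∃ S : Set (E → E), S.Finite ∧ (∀ h ∈ S, MemLp h P μ) ∧
    ∀ n, ∃ h ∈ S, eLpNorm (f n - h) P μ ≤ ε

variable {P : ℝ≥0∞} {μ : Measure E} {f : ℕ → E → E}

theorem TotBddLp.comp (h : TotBddLp P μ f) (φ : ℕ → ℕ) : TotBddLp P μ fun n => f (φ n) := by
  intro ε hε
  obtain ⟨S, h1, h2, h3⟩ := h ε hε
  exact ⟨S, h1, h2, fun n => h3 (φ n)⟩

theorem TotBddLp.const_smul (h : TotBddLp P μ f) (c : ℝ) : TotBddLp P μ fun n => c • f n := by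
  intro ε hε
  obtain ⟨a, ha, ha'⟩ := ENNReal.exists_nnreal_pos_mul_lt (a := ‖c‖ₑ) (by simp) hε.ne'
  obtain ⟨S, h1, h2, h3⟩ := h a (by exact_mod_cast ha)
  refine ⟨(fun k => c • k) '' S, h1.image _, ?_, fun n => ?_⟩
  · rintro _ ⟨k, hk, rfl⟩
    exact (h2 k hk).const_smul c
  · obtain ⟨k, hk, hk'⟩ := h3 n
    refine ⟨_, ⟨k, hk, rfl⟩, ?_⟩
    change eLpNorm (c • f n - c • k) P μ ≤ ε
    rw [← smul_sub, eLpNorm_const_smul]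
    calc ‖c‖ₑ * eLpNorm (f n - k) P μ ≤ ‖c‖ₑ * a := by gcongr
      _ ≤ ε := by rw [mul_comm]; exact ha'.le

/-- An approximation valid only for large `n` suffices: the finitely many remaining terms are added
to the net. -/
theorem TotBddLp.of_approx (hP : 1 ≤ P) (hf : ∀ n, MemLp (f n) P μ)
    (h : ∀ ε : ℝ≥0∞, 0 < ε → ∃ g : ℕ → E → E, (∀ n, AEStronglyMeasurable (g n) μ) ∧
      TotBddLp P μ g ∧ ∀ᶠ n in atTop, eLpNorm (f n - g n) P μ ≤ ε) :
    TotBddLp P μ f := by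
  intro ε hε
  have hε2 : 0 < ε / 2 := ENNReal.half_pos hε.ne'
  obtain ⟨g, hg, hgt, hev⟩ := h (ε / 2) hε2
  obtain ⟨N, hN⟩ := eventually_atTop.1 hev
  obtain ⟨S, h1, h2, h3⟩ := hgt (ε / 2) hε2
  refine ⟨S ∪ f '' Set.Iio N, h1.union ((Set.finite_Iio N).image _), ?_, fun n => ?_⟩
  · rintro k (hk | ⟨n, -, rfl⟩)
    exacts [h2 k hk, hf n]
  · rcases lt_or_ge n N with hn | hn
    · exact ⟨f n, Or.inr ⟨n, hn, rfl⟩, by simp⟩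
    · obtain ⟨k, hk, hk'⟩ := h3 n
      refine ⟨k, Or.inl hk, ?_⟩
      have : f n - k = (f n - g n) + (g n - k) := by abel
      rw [this]
      refine (eLpNorm_add_le ((hf n).1.sub (hg n)) ((hg n).sub (h2 k hk).1) hP).trans ?_
      exact (add_le_add (hN n hn) hk').trans (ENNReal.add_halves ε).le

theorem lintegral_enorm_apply_le {L : E → E →L[ℝ] E} {c : ℝ≥0∞} {B : Set E} {u : E → E}
    (hB : MeasurableSet B) (hu : Measurable u) (hc : ∀ y, ‖L y‖ₑ ≤ c) (h0 : ∀ y ∉ B, L y = 0) :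
    ∫⁻ y, ‖L y (u y)‖ₑ ∂μ ≤ c * ∫⁻ y in B, ‖u y‖ₑ ∂μ := by
  rw [← lintegral_const_mul _ hu.enorm, ← lintegral_indicator hB]
  refine lintegral_mono fun y => ?_
  by_cases hy : y ∈ B
  · simp only [Set.indicator_of_mem hy]
    exact ((L y).le_opENorm _).trans (by gcongr; exact hc y)
  · simp [h0 y hy]

/-- Moves the dependence on `x` from `u` to the kernel, whose uniform continuity then yields
equicontinuity. -/
theorem kernelOp_eq (K : E → E →L[ℝ] E) (u : E → E) (x : E) :
    kernelOp K u x = ∫ y, K (y - x) (u y) := by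
  rw [kernelOp, ← integral_sub_right_eq_self (fun z => K z (u (x + z))) x]
  simp

/-- Convolution operators with continuous compactly supported kernels are locally compact. -/
theorem totBddLp_kernelOp_of_continuous (hP : 1 ≤ P) {K : E → E →L[ℝ] E} (hK : Continuous K)
    (hKc : HasCompactSupport K) {u : ℕ → E → E} (hu : ∀ n, Measurable (u n)) {C : ℝ≥0∞}
    (hC : C ≠ ∞) (huC : ∀ n, eLpNorm (u n) P volume ≤ C) (R : ℝ)
    (hmem : ∀ n, MemLp (kernelOp K (u n)) P volume) :
    TotBddLp P (volume.restrict (Metric.closedBall 0 R)) fun n => kernelOp K (u n) := by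
  obtain ⟨r, hr⟩ := hKc.isCompact.isBounded.subset_closedBall (0 : E)
  set B : Set E := Metric.closedBall 0 (R + r) with hB
  have hBm : MeasurableSet B := measurableSet_closedBall
  -- On the bounded set `B` the `Lᵖ` bound gives a uniform `L¹` bound. Only values of `u n` on `B`
  -- matter for `x` in the ball of radius `R`.
  obtain ⟨M, hMtop, hM⟩ : ∃ M : ℝ≥0∞, M ≠ ∞ ∧ ∀ n, ∫⁻ y in B, ‖u n y‖ₑ ≤ M := by
    refine ⟨C * (volume.restrict B) Set.univ ^ (1 / (1 : ℝ≥0∞).toReal - 1 / P.toReal), ?_,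
      fun n => ?_⟩
    · refine ENNReal.mul_ne_top hC (ENNReal.rpow_ne_top_of_nonneg ?_ ?_)
      · rcases eq_or_ne P ∞ with rfl | hPt
        · simp
        · have : 1 ≤ P.toReal := by
            simpa using (ENNReal.toReal_le_toReal ENNReal.one_ne_top hPt).2 hP
          rw [ENNReal.toReal_one, div_one, sub_nonneg]
          exact (div_le_one (by linarith)).2 this
      · simp [hB, measure_closedBall_lt_top.ne]
    · rw [← eLpNorm_one_eq_lintegral_enorm]
      refine (eLpNorm_le_eLpNorm_mul_rpow_measure_univ hP
        (hu n).stronglyMeasurable.aestronglyMeasurable).trans ?_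
      gcongr
      exact (eLpNorm_mono_measure _ Measure.restrict_le_self).trans (huC n)
  obtain ⟨k, hk⟩ := hKc.exists_bound_of_continuous hK
  have hk' : ∀ y, ‖K y‖ₑ ≤ ENNReal.ofReal k := fun y => by
    rw [← ofReal_norm]; exact ENNReal.ofReal_le_ofReal (hk y)
  have hsupp : ∀ x ∈ Metric.closedBall (0 : E) R, ∀ y ∉ B, K (y - x) = 0 := by
    intro x hx y hy
    by_contra hne
    apply hy
    have := hr (subset_tsupport K (Function.mem_support.2 hne))
    rw [mem_closedBall_zero_iff] at this hx ⊢
    calc ‖y‖ = ‖x + (y - x)‖ := by simp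
      _ ≤ ‖x‖ + ‖y - x‖ := norm_add_le _ _
      _ ≤ R + r := add_le_add hx this
  have hint : ∀ n, ∀ x ∈ Metric.closedBall (0 : E) R, Integrable (fun y => K (y - x) (u n y)) := by
    intro n x hx
    refine ⟨(ContinuousLinearMap.apply ℝ E).flip.aestronglyMeasurable_comp₂
      (hK.comp (continuous_id.sub continuous_const)).aestronglyMeasurable
      (hu n).stronglyMeasurable.aestronglyMeasurable, ?_⟩
    refine (lintegral_enorm_apply_le hBm (hu n) (fun y => hk' (y - x)) (hsupp x hx)).trans_lt ?_
    exact ENNReal.mul_lt_top ENNReal.ofReal_lt_top ((hM n).trans_lt hMtop.lt_top)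
  have hbd : ∀ n, ∀ x ∈ Metric.closedBall (0 : E) R,
      ‖kernelOp K (u n) x‖ₑ ≤ ENNReal.ofReal k * M := by
    intro n x hx
    rw [kernelOp_eq]
    refine (enorm_integral_le_lintegral_enorm _).trans
      ((lintegral_enorm_apply_le hBm (hu n) (fun y => hk' (y - x)) (hsupp x hx)).trans ?_)
    gcongr
    exact hM n
  intro ε hε
  obtain ⟨a, ha, ha'⟩ := ENNReal.exists_nnreal_pos_mul_lt
    (a := (volume.restrict (Metric.closedBall (0 : E) R)) Set.univ ^ P.toReal⁻¹)
    (ENNReal.rpow_ne_top_of_nonneg (by positivity) (by simp [measure_closedBall_lt_top.ne])) hε.ne'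
  have ha3 : (0 : ℝ≥0∞) < a / 3 := ENNReal.div_pos (by exact_mod_cast ha.ne') (by simp)
  obtain ⟨ω, hω, hω'⟩ := ENNReal.exists_nnreal_pos_mul_lt hMtop ha3.ne'
  obtain ⟨η, hη, hη'⟩ := Metric.uniformContinuous_iff.1
    (hKc.uniformContinuous_of_continuous hK) ω (by exact_mod_cast hω)
  have hequi : ∀ n, ∀ x ∈ Metric.closedBall (0 : E) R, ∀ x' ∈ Metric.closedBall (0 : E) R,
      dist x x' < η → edist (kernelOp K (u n) x) (kernelOp K (u n) x') ≤ a / 3 := by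
    intro n x hx x' hx' hxx
    rw [edist_eq_enorm_sub, kernelOp_eq, kernelOp_eq, ← integral_sub (hint n x hx) (hint n x' hx')]
    simp only [← sub_apply]
    refine (enorm_integral_le_lintegral_enorm _).trans ?_
    refine (lintegral_enorm_apply_le (L := fun y => K (y - x) - K (y - x')) (c := ω) hBm (hu n)
      (fun y => ?_) (fun y hy => by rw [hsupp x hx y hy, hsupp x' hx' y hy, sub_zero])).trans ?_
    · have h1 := hη' (a := y - x) (b := y - x') (by rwa [dist_sub_left])
      rw [dist_eq_norm] at h1
      rw [← ofReal_norm, ENNReal.ofReal_le_iff_le_toReal ENNReal.coe_ne_top]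
      exact h1.le
    · exact (mul_le_mul_right (hM n) _).trans hω'.le
  obtain ⟨t, hts, htf, htc⟩ := Metric.finite_approx_of_totallyBounded
    (isCompact_closedBall (0 : E) R).totallyBounded η hη
  have := htf.fintype
  -- Arzelà–Ascoli by sampling: by equicontinuity each function is known up to `a / 3` from its
  -- values on the finite net `t`, and these values lie in a bounded subset of a finite-dimensional
  -- space.
  set G : ℕ → t → E := fun n i => kernelOp K (u n) i with hG
  have hGb : TotallyBounded (G '' Set.univ) := by
    refine (isCompact_closedBall (0 : t → E) (ENNReal.ofReal k * M).toReal).totallyBounded.subset ?_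
    rintro _ ⟨n, -, rfl⟩
    rw [mem_closedBall_zero_iff, pi_norm_le_iff_of_nonneg ENNReal.toReal_nonneg]
    intro i
    have := hbd n i (hts i.2)
    rwa [← ofReal_norm, ENNReal.ofReal_le_iff_le_toReal
      (ENNReal.mul_ne_top ENNReal.ofReal_ne_top hMtop)] at this
  obtain ⟨F, -, hFf, hFc⟩ := Set.exists_subset_image_finite_and.1
    (EMetric.totallyBounded_iff'.1 hGb (a / 3) ha3)
  refine ⟨(fun m => kernelOp K (u m)) '' F, hFf.image _, ?_, fun n => ?_⟩
  · rintro _ ⟨m, -, rfl⟩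
    exact (hmem m).restrict _
  · obtain ⟨_, ⟨m, hm, rfl⟩, hnm⟩ := Set.mem_iUnion₂.1 (hFc ⟨n, trivial, rfl⟩)
    refine ⟨_, ⟨m, hm, rfl⟩, ?_⟩
    refine (eLpNorm_le_of_ae_enorm_bound (C := a) ?_).trans ha'.le
    filter_upwards [ae_restrict_mem measurableSet_closedBall] with x hx
    obtain ⟨y, hy, hxy⟩ := Set.mem_iUnion₂.1 (htc hx)
    rw [Pi.sub_apply, ← edist_eq_enorm_sub]
    have h2 : edist (kernelOp K (u n) y) (kernelOp K (u m) y) ≤ a / 3 :=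
      (edist_le_pi_edist (G n) (G m) ⟨y, hy⟩).trans hnm.le
    have h3 := hequi n x hx y (hts hy) hxy
    have h4 := hequi m y (hts hy) x hx (by rw [dist_comm]; exact hxy)
    calc _ ≤ (a : ℝ≥0∞) / 3 + a / 3 + a / 3 :=
          (edist_triangle4 _ _ _ _).trans (add_le_add (add_le_add h3 h2) h4)
      _ = a := ENNReal.add_thirds _

/-- Continuous compactly supported kernels are dense in `L¹`, and by Young's inequality an
`L¹`-small change of kernel changes the images uniformly little in `Lᵖ`. -/
theorem totBddLp_kernelOp {p : ℝ} (hp : 1 ≤ p) {K : E → E →L[ℝ] E} (hK : Integrable K volume)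
    {u : ℕ → E → E} (hu : ∀ n, Measurable (u n))
    (hup : ∀ n, MemLp (u n) (ENNReal.ofReal p) volume) {C : ℝ≥0∞}
    (hC : C ≠ ∞) (huC : ∀ n, eLpNorm (u n) (ENNReal.ofReal p) volume ≤ C) (R : ℝ) :
    TotBddLp (ENNReal.ofReal p) (volume.restrict (Metric.closedBall 0 R))
      fun n => kernelOp K (u n) := by
  have hP : 1 ≤ ENNReal.ofReal p := by simpa using ENNReal.ofReal_le_ofReal hp
  refine TotBddLp.of_approx hP (fun n => (memLp_kernelOp hp hK (hu n) (hup n)).restrict _) ?_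
  intro ε hε
  obtain ⟨a, ha, ha'⟩ := ENNReal.exists_nnreal_pos_mul_lt hC hε.ne'
  obtain ⟨K', hK'c, hKK', hK'cont, hK'⟩ := hK.exists_hasCompactSupport_lintegral_sub_le
    (ε := a) (by exact_mod_cast ha.ne')
  refine ⟨fun n => kernelOp K' (u n), fun n => (memLp_kernelOp hp hK' (hu n) (hup n)).1.restrict,
    totBddLp_kernelOp_of_continuous hP hK'cont hK'c hu hC huC R
      (fun n => memLp_kernelOp hp hK' (hu n) (hup n)), Eventually.of_forall fun n => ?_⟩
  refine (eLpNorm_mono_measure _ Measure.restrict_le_self).trans ?_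
  rw [eLpNorm_congr_ae (kernelOp_sub_ae hp hK hK' (hu n) (hup n))]
  refine (eLpNorm_kernelOp_le hp (hK.sub hK') (hu n)).trans (le_trans ?_ ha'.le)
  exact mul_le_mul' hKK' (huC n)

/-- A bounded sequence in `Lᵖ` that is totally bounded on all balls has a subsequence that
converges in `Lᵖ` on all compact sets. -/
theorem exists_subseq_tendsto {p : ℝ} (hp : 1 ≤ p)
    (hf : ∀ n, MemLp (f n) (ENNReal.ofReal p) volume) {C : ℝ≥0∞}
    (hC : C ≠ ∞) (hfC : ∀ n, eLpNorm (f n) (ENNReal.ofReal p) volume ≤ C)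
    (htb : ∀ R : ℝ, TotBddLp (ENNReal.ofReal p) (volume.restrict (Metric.closedBall 0 R)) f) :
    ∃ ψ : ℕ → ℕ, StrictMono ψ ∧ ∃ v : E → E, ∀ K : Set E, IsCompact K →
      MemLp v (ENNReal.ofReal p) (volume.restrict K) ∧
      Tendsto (fun j => eLpNorm (f (ψ j) - v) (ENNReal.ofReal p) (volume.restrict K)) atTop
        (𝓝 0) := by
  set P := ENNReal.ofReal p with hPdef
  have h0 : 0 < p := by linarith
  have hP : 1 ≤ P := by simpa [hPdef] using ENNReal.ofReal_le_ofReal hp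
  have hPt : P ≠ ∞ := ENNReal.ofReal_ne_top
  have hPr : (1 / P).toReal = 1 / p := by simp [hPdef, ENNReal.toReal_ofReal h0.le]
  have : Fact (1 ≤ P) := ⟨hP⟩
  -- The weight `exp (-‖x‖)` replaces a diagonal argument: tails of an `Lᵖ`-bounded sequence are
  -- uniformly small for `μ`, while on each ball `μ` is comparable to Lebesgue measure. Compactness
  -- in `Lᵖ(μ)` therefore gives one subsequence for all compact sets.
  set w : E → ℝ≥0∞ := fun x => ENNReal.ofReal (Real.exp (-‖x‖)) with hw
  have hwm : Measurable w := by fun_prop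
  set μ : Measure E := volume.withDensity w with hμ
  have hμle : μ ≤ volume := by
    conv_rhs => rw [← withDensity_one (μ := (volume : Measure E))]
    refine withDensity_mono (Eventually.of_forall fun x => ?_)
    simp [hw]
  have hout : ∀ R : ℝ, μ.restrict (Metric.closedBall 0 R)ᶜ
      ≤ ENNReal.ofReal (Real.exp (-R)) • volume := by
    intro R
    rw [hμ, restrict_withDensity measurableSet_closedBall.compl, ← withDensity_const]
    refine (withDensity_mono ?_).trans ((restrict_withDensity measurableSet_closedBall.compl
      _).symm.trans_le Measure.restrict_le_self)
    filter_upwards [ae_restrict_mem measurableSet_closedBall.compl] with x hx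
    refine ENNReal.ofReal_le_ofReal (Real.exp_le_exp.2 ?_)
    simp at hx
    linarith
  have hin : ∀ R : ℝ, volume.restrict (Metric.closedBall (0 : E) R)
      ≤ ENNReal.ofReal (Real.exp R) • μ := by
    intro R
    conv_lhs => rw [← withDensity_one (μ := volume.restrict (Metric.closedBall (0 : E) R))]
    rw [hμ, ← withDensity_smul _ hwm]
    refine (withDensity_mono ?_).trans ((restrict_withDensity measurableSet_closedBall
      _).symm.trans_le Measure.restrict_le_self)
    filter_upwards [ae_restrict_mem measurableSet_closedBall] with x hx
    simp only [Pi.one_apply, Pi.smul_apply, smul_eq_mul, hw]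
    rw [← ENNReal.ofReal_mul (Real.exp_pos _).le, ← Real.exp_add, ENNReal.one_le_ofReal,
      Real.one_le_exp_iff]
    simp at hx
    linarith
  have hmem : ∀ n, MemLp (f n) P μ := fun n => (hf n).mono_measure hμle
  have hcompact : IsCompact (closure (Set.range fun n => (hmem n).toLp (f n))) := by
    refine TotallyBounded.isCompact_of_isClosed (TotallyBounded.closure ?_) isClosed_closure
    rw [EMetric.totallyBounded_iff]
    intro ε hε
    obtain ⟨ε', hε'0, hε'⟩ := exists_between hε
    have htail : Tendsto (fun R : ℝ => ENNReal.ofReal (Real.exp (-R)) ^ (1 / p) * C) atTop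
        (𝓝 0) := by
      have h1 : Tendsto (fun R : ℝ => ENNReal.ofReal (Real.exp (-R))) atTop (𝓝 0) := by
        rw [← ENNReal.ofReal_zero]
        exact ENNReal.tendsto_ofReal (Real.tendsto_exp_neg_atTop_nhds_zero)
      have h2 := (h1.ennrpow_const (1 / p))
      rw [ENNReal.zero_rpow_of_pos (by positivity)] at h2
      simpa using ENNReal.Tendsto.mul_const (b := C) h2 (Or.inr hC)
    obtain ⟨R, hR⟩ := (htail.eventually (gt_mem_nhds (ENNReal.half_pos hε'0.ne'))).exists
    obtain ⟨S, h1, h2, h3⟩ := htb R (ε' / 2) (ENNReal.half_pos hε'0.ne')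
    set B := Metric.closedBall (0 : E) R with hB
    have hBm : MeasurableSet B := measurableSet_closedBall
    have hrle : μ.restrict B ≤ volume.restrict B := Measure.restrict_mono_measure hμle B
    -- The members of the net are controlled only on `B`, so they are extended by zero.
    have hS : ∀ h ∈ S, MemLp (B.indicator h) P μ := fun h hh =>
      (memLp_indicator_iff_restrict hBm).2 ((h2 h hh).mono_measure hrle)
    refine ⟨Set.range fun h : S => (hS h h.2).toLp _, ?_, ?_⟩
    · have := h1.to_subtype
      exact Set.finite_range _
    · rintro _ ⟨n, rfl⟩
      obtain ⟨h, hh, hle⟩ := h3 n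
      refine Set.mem_iUnion₂.2 ⟨_, ⟨⟨h, hh⟩, rfl⟩, ?_⟩
      rw [Metric.mem_eball, Lp.edist_toLp_toLp]
      refine lt_of_le_of_lt ?_ hε'
      have hdec : f n - B.indicator h = B.indicator (f n - h) + Bᶜ.indicator (f n) := by
        ext1 x
        by_cases hx : x ∈ B <;> simp [hx]
      rw [hdec]
      have hm1 : AEStronglyMeasurable (B.indicator (f n - h)) μ :=
        (aestronglyMeasurable_indicator_iff hBm).2
          (((hmem n).1.restrict).sub ((h2 h hh).1.mono_measure hrle))
      refine (eLpNorm_add_le hm1 ((hmem n).1.indicator hBm.compl) hP).trans ?_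
      rw [eLpNorm_indicator_eq_eLpNorm_restrict hBm,
        eLpNorm_indicator_eq_eLpNorm_restrict hBm.compl, ← ENNReal.add_halves ε']
      refine add_le_add ((eLpNorm_mono_measure _ hrle).trans hle) ?_
      refine (eLpNorm_mono_measure _ (hout R)).trans ?_
      rw [eLpNorm_smul_measure_of_ne_top hPt, hPr, smul_eq_mul]
      exact (mul_le_mul_right (hfC n) _).trans hR.le
  obtain ⟨v, -, ψ, hψ, hlim⟩ := hcompact.tendsto_subseq
    (x := fun n => (hmem n).toLp (f n)) fun n => subset_closure ⟨n, rfl⟩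
  refine ⟨ψ, hψ, v, fun K hK => ?_⟩
  obtain ⟨R, hR⟩ := hK.isBounded.subset_closedBall (0 : E)
  have hKle : volume.restrict K ≤ ENNReal.ofReal (Real.exp R) • μ :=
    (Measure.restrict_mono hR le_rfl).trans (hin R)
  refine ⟨((Lp.memLp v).smul_measure ENNReal.ofReal_ne_top).mono_measure hKle, ?_⟩
  rw [tendsto_iff_edist_tendsto_0] at hlim
  have hlim' : Tendsto (fun j => eLpNorm (f (ψ j) - ⇑v) P μ) atTop (𝓝 0) := by
    refine hlim.congr fun j => ?_
    rw [Function.comp_apply, Lp.edist_def]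
    exact eLpNorm_congr_ae ((hmem (ψ j)).coeFn_toLp.sub (ae_eq_refl _))
  have hlim2 := ENNReal.Tendsto.const_mul (a := ENNReal.ofReal (Real.exp R) ^ (1 / p)) hlim'
    (Or.inr (ENNReal.rpow_ne_top_of_nonneg (by positivity) ENNReal.ofReal_ne_top))
  rw [mul_zero] at hlim2
  refine tendsto_of_tendsto_of_tendsto_of_le_of_le tendsto_const_nhds hlim2 (fun _ => zero_le)
    fun j => ?_
  refine (eLpNorm_mono_measure _ hKle).trans ?_
  rw [eLpNorm_smul_measure_of_ne_top hPt, hPr, smul_eq_mul]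

end TotallyBounded

/-! ### Pointwise lower bounds from weak convergence -/

section MonotoneKernels

variable {d : ℕ} {p : ℝ} {ρ : EuclideanSpace ℝ (Fin d) → ℝ}
  {ρn : ℕ → EuclideanSpace ℝ (Fin d) → ℝ}

/-- Test with `|z|⁻ᵖ` on the open shell between the radii `‖ξ‖` and `‖η‖`. By monotonicity the limit
integral is at least the shell's volume times the value at the outer radius, and the `n`-th integral
at most the volume times the value at the inner one. -/
theorem WeakTendstoL1Loc.eventually_lt_of_norm_lt (hp : 0 ≤ p) (hρ_loc : LocallyIntegrable ρ volume)
    (hρ_rad : RadialMonotone p ρ) (hρn_nonneg : ∀ n ξ, 0 ≤ ρn n ξ)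
    (hρn_rad : ∀ n, RadialMonotone p (ρn n)) (hweak : WeakTendstoL1Loc ρn ρ)
    {ξ η : EuclideanSpace ℝ (Fin d)} (hξ : 0 < ‖ξ‖) (hξη : ‖ξ‖ < ‖η‖) {c : ℝ}
    (hc : c < ‖η‖ ^ (-p) * ρ η) : ∀ᶠ n in atTop, c < ‖ξ‖ ^ (-p) * ρn n ξ := by
  set S : Set (EuclideanSpace ℝ (Fin d)) := {z | ‖ξ‖ < ‖z‖ ∧ ‖z‖ < ‖η‖} with hS
  have hSo : IsOpen S :=
    (isOpen_lt continuous_const continuous_norm).inter (isOpen_lt continuous_norm continuous_const)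
  have hSm : MeasurableSet S := hSo.measurableSet
  have hSsub : S ⊆ Metric.closedBall 0 ‖η‖ := fun z hz => by
    simpa using hz.2.le
  have hSfin : volume S ≠ ∞ :=
    ((measure_mono hSsub).trans_lt measure_closedBall_lt_top).ne
  have hSne : S.Nonempty := by
    refine ⟨((‖ξ‖ + ‖η‖) / 2 / ‖η‖) • η, ?_⟩
    have hη : 0 < ‖η‖ := hξ.trans hξη
    have : ‖((‖ξ‖ + ‖η‖) / 2 / ‖η‖) • η‖ = (‖ξ‖ + ‖η‖) / 2 := by
      rw [norm_smul, Real.norm_of_nonneg (by positivity)]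
      field_simp
    simp only [hS, Set.mem_ofPred_eq, this]
    constructor <;> linarith
  set V : ℝ := volume.real S with hV
  have hVpos : 0 < V := ENNReal.toReal_pos (hSo.measure_pos _ hSne).ne' hSfin
  set g : EuclideanSpace ℝ (Fin d) → ℝ := S.indicator fun z => ‖z‖ ^ (-p) with hg
  have hgm : Measurable g := Measurable.indicator (by fun_prop) hSm
  have hgb : ∀ z, |g z| ≤ ‖ξ‖ ^ (-p) := by
    intro z
    by_cases hz : z ∈ S
    · simp only [hg, Set.indicator_of_mem hz]
      rw [abs_of_nonneg (by positivity)]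
      exact Real.rpow_le_rpow_of_nonpos hξ hz.1.le (by linarith)
    · simp only [hg, Set.indicator_of_notMem hz, abs_zero]
      positivity
  have hgc : HasCompactSupport g := by
    refine HasCompactSupport.intro (isCompact_closedBall 0 ‖η‖) fun z hz => ?_
    exact Set.indicator_of_notMem (fun h => hz (hSsub h)) _
  have hlim := hweak g hgm ⟨_, hgb⟩ hgc
  have key : ∀ f : EuclideanSpace ℝ (Fin d) → ℝ,
      ∫ z, f z * g z = ∫ z in S, ‖z‖ ^ (-p) * f z := by
    intro f
    rw [← integral_indicator hSm]
    refine integral_congr_ae (Eventually.of_forall fun z => ?_)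
    by_cases hz : z ∈ S
    · simp [hg, hz, mul_comm]
    · simp [hg, hz]
  have hlow : V * (‖η‖ ^ (-p) * ρ η) ≤ ∫ z, ρ z * g z := by
    rw [key]
    have hint : IntegrableOn (fun z => ‖z‖ ^ (-p) * ρ z) S := by
      have h1 : IntegrableOn ρ S := (hρ_loc.integrableOn_isCompact
        (isCompact_closedBall 0 ‖η‖)).mono_set hSsub
      refine Integrable.bdd_mul (c := ‖ξ‖ ^ (-p)) h1
        (measurable_norm.pow_const _).aestronglyMeasurable ?_
      filter_upwards [ae_restrict_mem hSm] with z hz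
      have := hgb z
      simpa only [hg, Set.indicator_of_mem hz, Real.norm_eq_abs] using this
    have := setIntegral_mono_on (integrableOn_const hSfin (C := ‖η‖ ^ (-p) * ρ η)) hint hSm
      fun z hz => hρ_rad.2 z η (hξ.trans hz.1) hz.2.le
    simpa [hV] using this
  have hup : ∀ n, ∫ z, ρn n z * g z ≤ V * (‖ξ‖ ^ (-p) * ρn n ξ) := by
    intro n
    rw [key]
    have : ∫ z in S, ‖z‖ ^ (-p) * ρn n z ≤ ∫ z in S, ‖ξ‖ ^ (-p) * ρn n ξ := by
      refine integral_mono_of_nonneg (Eventually.of_forall fun z => ?_)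
        (integrableOn_const hSfin) ?_
      · exact mul_nonneg (by positivity) (hρn_nonneg n z)
      · filter_upwards [ae_restrict_mem hSm] with z hz
        exact (hρn_rad n).2 ξ z hξ hz.1.le
    simpa [hV] using this
  have hcV : V * c < ∫ z, ρ z * g z := (mul_lt_mul_of_pos_left hc hVpos).trans_le hlow
  filter_upwards [hlim.eventually (lt_mem_nhds hcV)] with n hn
  exact lt_of_mul_lt_mul_left (hn.trans_le (hup n)) hVpos.le

/-- Weak convergence of kernels that are monotone in the sense of `RadialMonotone` implies a
pointwise lower bound almost everywhere. -/
theorem WeakTendstoL1Loc.ae_eventually_lt [NeZero d] (hp : 0 ≤ p)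
    (hρ_loc : LocallyIntegrable ρ volume)
    (hρ_rad : RadialMonotone p ρ) (hρn_nonneg : ∀ n ξ, 0 ≤ ρn n ξ)
    (hρn_rad : ∀ n, RadialMonotone p (ρn n)) (hweak : WeakTendstoL1Loc ρn ρ) :
    ∀ᵐ ξ, ∀ c < ρ ξ, ∀ᶠ n in atTop, c < ρn n ξ := by
  obtain ⟨e, he⟩ : ∃ e : EuclideanSpace ℝ (Fin d), ‖e‖ = 1 := exists_norm_eq _ zero_le_one
  have hnorm : ∀ r : ℝ, 0 < r → ‖r • e‖ = r := fun r hr => by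
    rw [norm_smul, he, mul_one, Real.norm_of_nonneg hr.le]
  set Q : ℝ → ℝ := fun r => r ^ (-p) * ρ (r • e) with hQ
  have hQanti : AntitoneOn Q (Set.Ioi 0) := by
    intro r hr s hs hrs
    have := hρ_rad.2 (r • e) (s • e) (by rwa [hnorm r hr]) (by rwa [hnorm r hr, hnorm s hs])
    rwa [hnorm r hr, hnorm s hs] at this
  -- A monotone profile has countably many discontinuities, and the corresponding spheres are null.
  set N : Set ℝ := {r ∈ Set.Ioi (0 : ℝ) | ¬ContinuousWithinAt Q (Set.Ioi 0) r} with hN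
  have hNc : N.Countable := hQanti.countable_not_continuousWithinAt
  have hnull : ∀ᵐ ξ : EuclideanSpace ℝ (Fin d), ‖ξ‖ ∉ N := by
    have h1 : volume (⋃ r ∈ N, Metric.sphere (0 : EuclideanSpace ℝ (Fin d)) r) = 0 :=
      (measure_biUnion_null_iff hNc).2 fun r _ => Measure.addHaar_sphere _ _ _
    refine measure_mono_null (fun ξ hξ => ?_) h1
    simp only [Set.mem_compl_iff, Set.mem_ofPred_eq, not_not] at hξ
    simpa using hξ
  have hne : ∀ᵐ ξ : EuclideanSpace ℝ (Fin d), ξ ≠ 0 := by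
    simp [ae_iff]
  filter_upwards [hnull, hne] with ξ hξ hξ0 c hc
  have hpos : 0 < ‖ξ‖ := norm_pos_iff.2 hξ0
  have hpow : 0 < ‖ξ‖ ^ (-p) := Real.rpow_pos_of_pos hpos _
  have hcont : ContinuousAt Q ‖ξ‖ := by
    by_contra h
    exact hξ ⟨hpos, fun h' => h (h'.continuousAt (Ioi_mem_nhds hpos))⟩
  have hQξ : Q ‖ξ‖ = ‖ξ‖ ^ (-p) * ρ ξ := by
    simp only [hQ]
    rw [hρ_rad.1 _ ξ (hnorm _ hpos)]
  have hlt : ‖ξ‖ ^ (-p) * c < Q ‖ξ‖ := by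
    rw [hQξ]
    exact mul_lt_mul_of_pos_left hc hpow
  -- By continuity the strict bound persists at a slightly larger radius `s`, which serves as the
  -- outer radius of the shell.
  obtain ⟨s, hs, hs'⟩ := ((hcont.eventually (lt_mem_nhds hlt)).filter_mono
    (nhdsWithin_le_nhds (s := Set.Ioi ‖ξ‖))).and self_mem_nhdsWithin |>.exists
  have hs0 : 0 < s := hpos.trans hs'
  have := hweak.eventually_lt_of_norm_lt hp hρ_loc hρ_rad hρn_nonneg hρn_rad hpos
    (η := s • e) (by rw [hnorm s hs0]; exact hs') (c := ‖ξ‖ ^ (-p) * c) (by rw [hnorm s hs0]; exact hs)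
  filter_upwards [this] with n hn
  exact lt_of_mul_lt_mul_left hn hpow.le

theorem ofReal_le_liminf {a : ℝ} {b : ℕ → ℝ} (h : ∀ c < a, ∀ᶠ n in atTop, c < b n) :
    ENNReal.ofReal a ≤ liminf (fun n => ENNReal.ofReal (b n)) atTop := by
  refine le_of_forall_lt fun c hc => ?_
  obtain ⟨c', hcc', hc'⟩ := exists_between hc
  refine hcc'.trans_le (le_liminf_of_le (by isBoundedDefault) ?_)
  filter_upwards [h c'.toReal ((ENNReal.lt_ofReal_iff_toReal_lt (hc'.ne_top)).1 hc')] with n hn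
  exact ((ENNReal.lt_ofReal_iff_toReal_lt hc'.ne_top).2 hn).le

theorem setLIntegral_ofReal_ball_lt_top (hρ_loc : LocallyIntegrable ρ volume) (δ : ℝ) :
    ∫⁻ ξ in Metric.ball 0 δ, ENNReal.ofReal (ρ ξ) < ∞ := by
  have h1 : IntegrableOn ρ (Metric.ball 0 δ) := (hρ_loc.integrableOn_isCompact
    (isCompact_closedBall 0 δ)).mono_set Metric.ball_subset_closedBall
  exact (lintegral_ofReal_le_lintegral_enorm ρ).trans_lt h1.2

/-- Truncated subtraction keeps only the deficit of `ρn` below `ρ`, so the one-sided bound suffices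
and `ρ` itself dominates. -/
theorem tendsto_setLIntegral_ofReal_tsub (hρ_loc : LocallyIntegrable ρ volume)
    (hρn_loc : ∀ n, LocallyIntegrable (ρn n) volume)
    (h : ∀ᵐ ξ, ∀ c < ρ ξ, ∀ᶠ n in atTop, c < ρn n ξ) (δ : ℝ) :
    Tendsto (fun n => ∫⁻ ξ in Metric.ball 0 δ, (ENNReal.ofReal (ρ ξ) - ENNReal.ofReal (ρn n ξ)))
      atTop (𝓝 0) := by
  have hm : AEMeasurable (fun ξ => ENNReal.ofReal (ρ ξ)) volume :=
    hρ_loc.aestronglyMeasurable.aemeasurable.ennreal_ofReal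
  have hmn : ∀ n, AEMeasurable (fun ξ => ENNReal.ofReal (ρn n ξ)) volume :=
    fun n => (hρn_loc n).aestronglyMeasurable.aemeasurable.ennreal_ofReal
  rw [← lintegral_zero (μ := volume.restrict (Metric.ball (0 : EuclideanSpace ℝ (Fin d)) δ))]
  refine tendsto_lintegral_of_dominated_convergence' (fun ξ => ENNReal.ofReal (ρ ξ))
    (fun n => (hm.sub (hmn n)).restrict) (fun n => Eventually.of_forall fun ξ => tsub_le_self)
    (setLIntegral_ofReal_ball_lt_top hρ_loc δ).ne ?_
  filter_upwards [ae_restrict_of_ae h] with ξ hξ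
  rw [ENNReal.tendsto_nhds_zero]
  intro ε hε
  rcases eq_or_ne ε ∞ with rfl | hε'
  · simp
  filter_upwards [hξ (ρ ξ - ε.toReal) (by
    have := ENNReal.toReal_pos hε.ne' hε'
    linarith)] with n hn
  rw [tsub_le_iff_right, ← ENNReal.ofReal_toReal hε']
  refine (ENNReal.ofReal_le_ofReal (q := ε.toReal + ρn n ξ) (by linarith)).trans
    ENNReal.ofReal_add_le

end MonotoneKernels

/-! ### The rank-one kernel and its isotropy -/

section ProjKernel

set_option linter.unusedSectionVars false

variable {E : Type*} [NormedAddCommGroup E] [InnerProductSpace ℝ E] [FiniteDimensional ℝ E]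
  [MeasurableSpace E] [BorelSpace E]

/-- The matrix-valued kernel `w(z) ẑ ⊗ ẑ` with `ẑ = z / |z|`. -/
noncomputable def projKernel (w : E → ℝ) (z : E) : E →L[ℝ] E :=
  w z • (innerSL ℝ (‖z‖⁻¹ • z)).smulRight (‖z‖⁻¹ • z)

theorem projKernel_apply (w : E → ℝ) (z a : E) :
    projKernel w z a = w z • (inner ℝ (‖z‖⁻¹ • z) a : ℝ) • (‖z‖⁻¹ • z) := by
  rfl

theorem norm_inv_smul_self_le (z : E) : ‖‖z‖⁻¹ • z‖ ≤ 1 := by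
  rw [norm_smul, norm_inv, norm_norm]
  exact inv_mul_le_one

theorem integrable_projKernel {w : E → ℝ} (hw : Integrable w volume) :
    Integrable (projKernel w) volume := by
  have hm : StronglyMeasurable fun z : E =>
      (innerSL ℝ (‖z‖⁻¹ • z)).smulRight (‖z‖⁻¹ • z) := by
    have h1 : Continuous fun v : E => (innerSL ℝ v).smulRight v := by fun_prop
    have h2 : Measurable fun z : E => ‖z‖⁻¹ • z := by fun_prop
    exact h1.comp_stronglyMeasurable h2.stronglyMeasurable
  refine hw.smul_bdd 1 hm.aestronglyMeasurable (Eventually.of_forall fun z => ?_)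
  rw [ContinuousLinearMap.norm_smulRight_apply, innerSL_apply_norm]
  exact mul_le_one₀ (norm_inv_smul_self_le z) (norm_nonneg _) (norm_inv_smul_self_le z)

theorem integral_mul_inner_sq_eq {w : E → ℝ} (hrad : ∀ z z' : E, ‖z‖ = ‖z'‖ → w z = w z')
    {a b : E} (hab : ‖a‖ = ‖b‖) :
    ∫ z, w z * (inner ℝ (‖z‖⁻¹ • z) a : ℝ) ^ 2 = ∫ z, w z * (inner ℝ (‖z‖⁻¹ • z) b : ℝ) ^ 2 := by
  -- This reflection carries `a` to `b` and preserves both norm and volume.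
  set T := (ℝ ∙ (a - b))ᗮ.reflection with hT
  have hTa : T a = b := Submodule.reflection_sub hab
  rw [← (T.measurePreserving).integral_comp (T.toHomeomorph.measurableEmbedding)
    (fun z => w z * (inner ℝ (‖z‖⁻¹ • z) b : ℝ) ^ 2)]
  refine integral_congr_ae (Eventually.of_forall fun z => ?_)
  simp only
  rw [hrad (T z) z (T.norm_map z), T.norm_map, ← hTa, ← T.map_smul, T.inner_map_map]

/-- The second moments of a radial function are isotropic. -/
theorem integral_projKernel_apply [Nontrivial E] {w : E → ℝ} (hw : Integrable w volume)
    (hrad : ∀ z z' : E, ‖z‖ = ‖z'‖ → w z = w z') (a : E) :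
    ∫ z, projKernel w z a = ((∫ z, w z) / Module.finrank ℝ E) • a := by
  have hne : (Module.finrank ℝ E : ℝ) ≠ 0 := by
    exact_mod_cast (Module.finrank_pos (R := ℝ) (M := E)).ne'
  set c : ℝ := (∫ z, w z) / Module.finrank ℝ E with hc
  set Q : E → ℝ := fun a => ∫ z, w z * (inner ℝ (‖z‖⁻¹ • z) a : ℝ) ^ 2 with hQ
  have hint2 : ∀ a b : E, Integrable fun z =>
      w z * ((inner ℝ (‖z‖⁻¹ • z) a : ℝ) * inner ℝ (‖z‖⁻¹ • z) b) := by
    intro a b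
    refine hw.mul_bdd (c := ‖a‖ * ‖b‖) (Measurable.aestronglyMeasurable (by fun_prop))
      (Eventually.of_forall fun z => ?_)
    rw [norm_mul]
    refine mul_le_mul ?_ ?_ (norm_nonneg _) (norm_nonneg _)
    · exact (norm_inner_le_norm _ _).trans
        (mul_le_of_le_one_left (norm_nonneg _) (norm_inv_smul_self_le z))
    · exact (norm_inner_le_norm _ _).trans
        (mul_le_of_le_one_left (norm_nonneg _) (norm_inv_smul_self_le z))
  have hint : ∀ a : E, Integrable fun z => w z * (inner ℝ (‖z‖⁻¹ • z) a : ℝ) ^ 2 := by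
    intro a
    simpa only [sq] using hint2 a a
  have hunit : ∀ e : E, ‖e‖ = 1 → Q e = c := by
    intro e he
    let b := stdOrthonormalBasis ℝ E
    -- The trace of `ẑ ⊗ ẑ` is `1`; since all unit vectors give the same value of `Q`, that value is
    -- `c`.
    have h1 : ∑ i, Q (b i) = ∫ z, w z := by
      simp only [hQ]
      rw [← integral_finsetSum _ fun i _ => hint (b i)]
      have hz : ∀ᵐ z : E, z ≠ 0 := by simp [ae_iff]
      refine integral_congr_ae ?_
      filter_upwards [hz] with z hz
      rw [← Finset.mul_sum]
      have hz' : ‖z‖ ≠ 0 := norm_ne_zero_iff.2 hz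
      have := b.sum_sq_norm_inner_left (‖z‖⁻¹ • z)
      simp only [Real.norm_eq_abs, sq_abs] at this
      rw [this, norm_smul, norm_inv, norm_norm, inv_mul_cancel₀ hz']
      simp
    have h2 : ∀ i, Q (b i) = Q e := fun i =>
      integral_mul_inner_sq_eq hrad (by rw [he]; exact b.orthonormal.1 i)
    simp only [h2, Finset.sum_const, Finset.card_univ, Fintype.card_fin, nsmul_eq_mul] at h1
    rw [hc, ← h1]
    field_simp
  have hQa : ∀ a, Q a = c * ‖a‖ ^ 2 := by
    intro a
    obtain ⟨e, he⟩ : ∃ e : E, ‖e‖ = 1 := exists_norm_eq _ zero_le_one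
    have h1 : Q a = Q (‖a‖ • e) := integral_mul_inner_sq_eq hrad (by simp [norm_smul, he])
    rw [h1, ← hunit e he]
    simp only [hQ]
    rw [← integral_mul_const]
    refine integral_congr_ae (Eventually.of_forall fun z => ?_)
    simp only [inner_smul_right]
    ring
  refine ext_inner_left ℝ fun b => ?_
  rw [← integral_inner ((integrable_projKernel hw).apply_continuousLinearMap a), inner_smul_right]
  -- Polarisation recovers the bilinear form from `Q`.
  have h1 : ∀ z, (inner ℝ b (projKernel w z a) : ℝ) =
      (1 / 4) * (w z * (inner ℝ (‖z‖⁻¹ • z) (a + b) : ℝ) ^ 2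
        - w z * (inner ℝ (‖z‖⁻¹ • z) (a - b) : ℝ) ^ 2) := by
    intro z
    rw [projKernel_apply, inner_smul_right, inner_smul_right, inner_add_right, inner_sub_right,
      real_inner_comm (‖z‖⁻¹ • z) b]
    ring
  simp only [h1]
  rw [integral_const_mul, integral_sub (hint _) (hint _)]
  change 1 / 4 * (Q (a + b) - Q (a - b)) = _
  rw [hQa, hQa, norm_add_sq_real, norm_sub_sq_real, real_inner_comm a b]
  ring

theorem enorm_kernelOp_projKernel_sub_le [Nontrivial E] {w : E → ℝ} (hw : Integrable w volume)
    (hrad : ∀ z z' : E, ‖z‖ = ‖z'‖ → w z = w z') {u : E → E} {x : E}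
    (hx : Integrable (fun z => projKernel w z (u (x + z))) volume) :
    ‖kernelOp (projKernel w) u x - ((∫ z, w z) / Module.finrank ℝ E) • u x‖ₑ
      ≤ ∫⁻ z, ‖w z‖ₑ * ‖(inner ℝ (‖z‖⁻¹ • z) (u (x + z) - u x) : ℝ)‖ₑ := by
  rw [← integral_projKernel_apply hw hrad, kernelOp,
    ← integral_sub hx ((integrable_projKernel hw).apply_continuousLinearMap (u x))]
  refine (enorm_integral_le_lintegral_enorm _).trans (lintegral_mono fun z => ?_)
  rw [← map_sub, projKernel_apply, enorm_smul, enorm_smul]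
  gcongr
  refine mul_le_of_le_one_right' ?_
  rw [← ofReal_norm, ENNReal.ofReal_le_one]
  exact norm_inv_smul_self_le z

/-- Here `k` plays the role of `ρₙ`. The part of `w` below `k` multiplies the directional difference
and is handled by Jensen; the excess of `w` over `k` multiplies the crude bound `|u(x + z)| +
|u(x)|`, whence the factor `2`. -/
theorem eLpNorm_kernelOp_projKernel_sub_le [Nontrivial E] {p : ℝ} (hp : 1 ≤ p) {w : E → ℝ}
    (hw : Integrable w volume) (hw0 : ∀ z, 0 ≤ w z)
    (hrad : ∀ z z' : E, ‖z‖ = ‖z'‖ → w z = w z') {k : E → ℝ≥0∞} (hk : AEMeasurable k volume)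
    {u : E → E} (hu : Measurable u) (hup : MemLp u (ENNReal.ofReal p) volume) :
    eLpNorm (kernelOp (projKernel w) u - ((∫ z, w z) / Module.finrank ℝ E) • u)
        (ENNReal.ofReal p) volume
      ≤ (∫⁻ z, ENNReal.ofReal (w z)) ^ (1 - 1 / p) *
          (∫⁻ z, min (k z) (ENNReal.ofReal (w z)) *
            ∫⁻ x, ‖(inner ℝ (‖z‖⁻¹ • z) (u (x + z) - u x) : ℝ)‖ₑ ^ p) ^ (1 / p)
        + 2 * (∫⁻ z, (ENNReal.ofReal (w z) - k z)) * eLpNorm u (ENNReal.ofReal p) volume := by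
  have hP : 1 ≤ ENNReal.ofReal p := by simpa using ENNReal.ofReal_le_ofReal hp
  have h0 : 0 < p := by linarith
  set W : E → ℝ≥0∞ := fun z => ENNReal.ofReal (w z) with hW
  have hWm : AEMeasurable W volume := hw.aestronglyMeasurable.aemeasurable.ennreal_ofReal
  have hlm : AEMeasurable (fun z => min (k z) (W z)) volume := hk.min hWm
  have hdm : AEMeasurable (fun z => W z - k z) volume := hWm.sub hk
  set F : E → E → ℝ≥0∞ := fun x z => ‖(inner ℝ (‖z‖⁻¹ • z) (u (x + z) - u x) : ℝ)‖ₑ with hF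
  have hFm : Measurable (Function.uncurry F) := by
    have h1 : Measurable fun q : E × E => u (q.1 + q.2) := hu.comp measurable_add
    have h2 : Measurable fun q : E × E => u q.1 := hu.comp measurable_fst
    have h3 : Measurable fun q : E × E => ‖q.2‖⁻¹ • q.2 := by fun_prop
    exact (h3.inner (h1.sub h2)).enorm
  have hFle : ∀ x z, F x z ≤ ‖u (x + z)‖ₑ + ‖u x‖ₑ := by
    intro x z
    have h1 : F x z ≤ ‖u (x + z) - u x‖ₑ := by
      simp only [hF]
      rw [← ofReal_norm, ← ofReal_norm]
      exact ENNReal.ofReal_le_ofReal ((norm_inner_le_norm _ _).trans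
        (mul_le_of_le_one_left (norm_nonneg _) (norm_inv_smul_self_le z)))
    exact h1.trans (enorm_sub_le)
  set G₁ : E → ℝ≥0∞ := fun x => ∫⁻ z, min (k z) (W z) * F x z with hG₁
  set G₂ : E → ℝ≥0∞ := fun x => ∫⁻ z, (W z - k z) * ‖u (x + z)‖ₑ with hG₂
  set G₃ : E → ℝ≥0∞ := fun x => (∫⁻ z, (W z - k z)) * ‖u x‖ₑ with hG₃
  have hG₁m : AEStronglyMeasurable G₁ volume :=
    (AEMeasurable.lintegral_prod_right' (f := fun q : E × E => min (k q.2) (W q.2) * F q.1 q.2)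
      (hlm.comp_snd.mul hFm.aemeasurable)).aestronglyMeasurable
  have hG₂m : AEStronglyMeasurable G₂ volume :=
    (AEMeasurable.lintegral_prod_right' (f := fun q : E × E => (W q.2 - k q.2) * ‖u (q.1 + q.2)‖ₑ)
      (hdm.comp_snd.mul (hu.comp measurable_add).enorm.aemeasurable)).aestronglyMeasurable
  have hG₃m : AEStronglyMeasurable G₃ volume := (hu.enorm.const_mul _).aestronglyMeasurable
  have hpt : ∀ᵐ x, ‖(kernelOp (projKernel w) u - ((∫ z, w z) / Module.finrank ℝ E) • u) x‖ₑ
      ≤ ‖(G₁ + (G₂ + G₃)) x‖ₑ := by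
    filter_upwards [ae_integrable_kernel_apply hp (integrable_projKernel hw) hu hup] with x hx
    rw [enorm_eq_self]
    refine (enorm_kernelOp_projKernel_sub_le hw hrad hx).trans ?_
    have hux : AEMeasurable (fun z => ‖u (x + z)‖ₑ) volume :=
      (hu.comp (measurable_const_add x)).enorm.aemeasurable
    have hdux : AEMeasurable (fun z => (W z - k z) * ‖u (x + z)‖ₑ) volume := hdm.mul hux
    have hlF : AEMeasurable (fun z => min (k z) (W z) * F x z) volume :=
      hlm.mul (hFm.of_uncurry_left).aemeasurable
    simp only [Pi.add_apply, hG₁, hG₂, hG₃]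
    rw [← lintegral_mul_const'' _ hdm, ← lintegral_add_left' hdux, ← lintegral_add_left' hlF]
    refine lintegral_mono fun z => ?_
    have hWz : ‖w z‖ₑ = min (k z) (W z) + (W z - k z) := by
      rw [Real.enorm_eq_ofReal (hw0 z)]
      rcases le_total (k z) (W z) with h | h
      · rw [min_eq_left h, add_tsub_cancel_of_le h]
      · rw [min_eq_right h, tsub_eq_zero_of_le h, add_zero]
    simp only
    rw [hWz, add_mul, ← mul_add]
    exact add_le_add le_rfl (mul_le_mul_right (hFle x z) _)
  refine (eLpNorm_mono_enorm_ae hpt).trans ((eLpNorm_add_le hG₁m (hG₂m.add hG₃m) hP).trans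
    (add_le_add ?_ ((eLpNorm_add_le hG₂m hG₃m hP).trans ?_)))
  · refine (eLpNorm_lintegral_mul_le hp hlm hFm).trans ?_
    gcongr
    · rw [sub_nonneg, div_le_one h0]; exact hp
    · exact min_le_right _ _
  · have h2 : eLpNorm G₂ (ENNReal.ofReal p) volume
        ≤ (∫⁻ z, (W z - k z)) * eLpNorm u (ENNReal.ofReal p) volume := by
      have := eLpNorm_lintegral_mul_translate_le hp hdm hu.enorm
      rwa [show eLpNorm (fun x => ‖u x‖ₑ) (ENNReal.ofReal p) volume
        = eLpNorm u (ENNReal.ofReal p) volume from eLpNorm_enorm u] at this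
    have h3 : eLpNorm G₃ (ENNReal.ofReal p) volume
        ≤ (∫⁻ z, (W z - k z)) * eLpNorm u (ENNReal.ofReal p) volume := by
      rw [eLpNorm_eq_lintegral_rpow_enorm_toReal (by simpa using h0) (by simp),
        eLpNorm_eq_lintegral_rpow_enorm_toReal (by simpa using h0) (by simp),
        ENNReal.toReal_ofReal h0.le]
      simp only [hG₃, enorm_eq_self, ENNReal.mul_rpow_of_nonneg _ _ h0.le]
      rw [lintegral_const_mul _ (hu.enorm.pow_const p),
        ENNReal.mul_rpow_of_nonneg _ _ (by positivity), ← ENNReal.rpow_mul]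
      simp [h0.ne']
    calc _ ≤ _ := add_le_add h2 h3
      _ = _ := by ring

end ProjKernel

/-! ### Energy estimates, compactness and lower semicontinuity -/

section Compactness

variable {d : ℕ} {p : ℝ} {ρ : EuclideanSpace ℝ (Fin d) → ℝ}
  {u : EuclideanSpace ℝ (Fin d) → EuclideanSpace ℝ (Fin d)}

theorem measurable_projDiffQuot (hu : Measurable u) :
    Measurable fun q : EuclideanSpace ℝ (Fin d) × EuclideanSpace ℝ (Fin d) =>
      projDiffQuot u q.1 q.2 := by
  have h1 : Measurable fun q : EuclideanSpace ℝ (Fin d) × EuclideanSpace ℝ (Fin d) =>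
    u q.1 := hu.comp measurable_fst
  have h2 : Measurable fun q : EuclideanSpace ℝ (Fin d) × EuclideanSpace ℝ (Fin d) =>
    u q.2 := hu.comp measurable_snd
  unfold projDiffQuot
  fun_prop

theorem measurable_ofReal_projDiffQuot (hu : Measurable u) (p : ℝ) :
    Measurable fun q : EuclideanSpace ℝ (Fin d) × EuclideanSpace ℝ (Fin d) =>
      ENNReal.ofReal (|projDiffQuot u q.1 q.2| ^ p) := by
  have := measurable_projDiffQuot hu
  exact (this.abs.pow_const p).ennreal_ofReal

theorem enorm_inner_rpow_eq (hp : 0 < p) (x z : EuclideanSpace ℝ (Fin d)) :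
    ‖(inner ℝ (‖z‖⁻¹ • z) (u (x + z) - u x) : ℝ)‖ₑ ^ p
      = ENNReal.ofReal (‖z‖ ^ p) * ENNReal.ofReal (|projDiffQuot u x (x + z)| ^ p) := by
  have h : ‖(inner ℝ (‖z‖⁻¹ • z) (u (x + z) - u x) : ℝ)‖ = ‖z‖ * |projDiffQuot u x (x + z)| := by
    simp only [projDiffQuot, add_sub_cancel_left]
    rw [real_inner_smul_left _ (‖z‖⁻¹ • z), abs_mul, Real.norm_eq_abs,
      real_inner_comm (u (x + z) - u x)]
    rcases eq_or_ne z 0 with rfl | hz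
    · simp
    · have : ‖z‖ ≠ 0 := norm_ne_zero_iff.2 hz
      rw [abs_of_nonneg (inv_nonneg.2 (norm_nonneg z)), mul_inv_cancel_left₀ this]
  rw [← ofReal_norm, h, ENNReal.ofReal_rpow_of_nonneg (by positivity) hp.le,
    Real.mul_rpow (by positivity) (by positivity), ENNReal.ofReal_mul (by positivity)]

theorem lintegral_mul_lintegral_shift {E : Type*} [NormedAddCommGroup E] [InnerProductSpace ℝ E]
    [FiniteDimensional ℝ E] [MeasurableSpace E] [BorelSpace E] {k : E → ℝ≥0∞} {D : E → E → ℝ≥0∞}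
    (hk : AEMeasurable k volume) (hD : Measurable (Function.uncurry D)) :
    ∫⁻ z, k z * ∫⁻ x, D x (x + z) = ∫⁻ x, ∫⁻ y, k (y - x) * D x y := by
  have hDm : Measurable fun q : E × E => D q.1 (q.1 + q.2) :=
    hD.comp (measurable_fst.prodMk measurable_add)
  have hm : AEMeasurable (Function.uncurry fun x z => k z * D x (x + z)) (volume.prod volume) :=
    hk.comp_snd.mul hDm.aemeasurable
  have h1 : ∀ z, k z * ∫⁻ x, D x (x + z) = ∫⁻ x, k z * D x (x + z) := fun z =>
    (lintegral_const_mul _ (hDm.comp measurable_prodMk_right)).symm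
  have h2 : ∀ x, ∫⁻ z, k z * D x (x + z) = ∫⁻ y, k (y - x) * D x y := by
    intro x
    rw [← lintegral_add_left_eq_self (fun y => k (y - x) * D x y) x]
    simp only [add_sub_cancel_left]
  simp only [h1]
  rw [← lintegral_lintegral_swap hm]
  simp only [h2]

/-- The squared factor `|z|⁻²` in the quotient leaves a surplus `|z|ᵖ`, at most `δᵖ` on the ball;
off the ball the minimum vanishes. -/
theorem lintegral_min_mul_le (hp : 0 < p) (hρ : AEMeasurable ρ volume) (hu : Measurable u)
    {w : EuclideanSpace ℝ (Fin d) → ℝ} {δ : ℝ} (hw : ∀ z ∉ Metric.ball 0 δ, w z = 0) :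
    ∫⁻ z, min (ENNReal.ofReal (ρ z)) (ENNReal.ofReal (w z)) *
        ∫⁻ x, ‖(inner ℝ (‖z‖⁻¹ • z) (u (x + z) - u x) : ℝ)‖ₑ ^ p
      ≤ ENNReal.ofReal (δ ^ p) * ∫⁻ x, ∫⁻ y,
          ENNReal.ofReal (ρ (y - x)) * ENNReal.ofReal (|projDiffQuot u x y| ^ p) := by
  have hρm : AEMeasurable (fun z => ENNReal.ofReal (ρ z)) volume := hρ.ennreal_ofReal
  have hDm : Measurable (Function.uncurry fun x y =>
      ENNReal.ofReal (|projDiffQuot u x y| ^ p)) := measurable_ofReal_projDiffQuot hu p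
  rw [← lintegral_mul_lintegral_shift hρm hDm, ← lintegral_const_mul' _ _ ENNReal.ofReal_ne_top]
  refine lintegral_mono fun z => ?_
  by_cases hz : z ∈ Metric.ball 0 δ
  · simp only [enorm_inner_rpow_eq hp]
    rw [lintegral_const_mul' _ _ ENNReal.ofReal_ne_top, mul_left_comm (ENNReal.ofReal (δ ^ p))]
    refine mul_le_mul' (min_le_left _ _) (mul_le_mul' (ENNReal.ofReal_le_ofReal
      (Real.rpow_le_rpow (norm_nonneg _) (mem_ball_zero_iff.1 hz).le hp.le)) le_rfl)
  · rw [hw z hz, ENNReal.ofReal_zero, min_eq_right zero_le, zero_mul]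
    exact zero_le

theorem seminorm_rpow_eq (hp : 0 < p) (Ω : Set (EuclideanSpace ℝ (Fin d))) :
    ∫⁻ x in Ω, ∫⁻ y in Ω, ENNReal.ofReal (ρ (y - x)) * ENNReal.ofReal (|projDiffQuot u x y| ^ p)
      = seminorm ρ p Ω u ^ p := by
  rw [seminorm, ← ENNReal.rpow_mul, one_div_mul_cancel hp.ne', ENNReal.rpow_one]

theorem seminorm_congr_ae {v : EuclideanSpace ℝ (Fin d) → EuclideanSpace ℝ (Fin d)}
    {Ω : Set (EuclideanSpace ℝ (Fin d))} (h : u =ᵐ[volume.restrict Ω] v) :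
    seminorm ρ p Ω u = seminorm ρ p Ω v := by
  unfold seminorm
  congr 1
  refine lintegral_congr_ae ?_
  filter_upwards [h] with x hx
  refine lintegral_congr_ae ?_
  filter_upwards [h] with y hy
  simp only [projDiffQuot, hx, hy]

/-- The mass is nonzero because a quotient below `1` excludes the value `∞` taken at denominator
`0`. -/
theorem SufficientlySingular.exists_pos (hp : 0 < p) (hsing : SufficientlySingular p ρ)
    {C ε : ℝ≥0∞} (hC : C ≠ ∞) (hε : 0 < ε) :
    ∃ δ : ℝ, 0 < δ ∧ (∫⁻ ξ in Metric.ball 0 δ, ENNReal.ofReal (ρ ξ)) ≠ 0 ∧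
      (ENNReal.ofReal (δ ^ p) / ∫⁻ ξ in Metric.ball 0 δ, ENNReal.ofReal (ρ ξ)) ^ (1 / p) * C < ε := by
  have h1 := ENNReal.Tendsto.mul_const (b := C)
    (Tendsto.ennrpow_const (1 / p) hsing) (Or.inr hC)
  rw [ENNReal.zero_rpow_of_pos (by positivity), zero_mul] at h1
  obtain ⟨δ, ⟨h2, h3⟩, hδ⟩ := ((h1.eventually (gt_mem_nhds hε)).and
    (hsing.eventually (gt_mem_nhds zero_lt_one))).and self_mem_nhdsWithin |>.exists
  have hδ0 : 0 < δ := hδ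
  refine ⟨δ, hδ0, fun h0 => ?_, h2⟩
  rw [h0, ENNReal.div_zero (by simpa using Real.rpow_pos_of_pos hδ0 p)] at h3
  simp at h3

variable {ρn : ℕ → EuclideanSpace ℝ (Fin d) → ℝ}
  {un : ℕ → EuclideanSpace ℝ (Fin d) → EuclideanSpace ℝ (Fin d)}

/-- A sequence with bounded energies is uniformly close to its image under a convolution
operator. -/
theorem exists_kernel_approx [NeZero d] (hp : 1 ≤ p) (hρ_nonneg : ∀ ξ, 0 ≤ ρ ξ)
    (hρ_loc : LocallyIntegrable ρ volume) (hρ_rad : RadialMonotone p ρ)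
    (hsing : SufficientlySingular p ρ) (hρn_loc : ∀ n, LocallyIntegrable (ρn n) volume)
    (hlim : ∀ᵐ ξ, ∀ c < ρ ξ, ∀ᶠ n in atTop, c < ρn n ξ)
    (hm : ∀ n, Measurable (un n)) (hup : ∀ n, MemLp (un n) (ENNReal.ofReal p) volume)
    {C : ℝ≥0∞} (hC : C ≠ ∞) (hC1 : ∀ n, eLpNorm (un n) (ENNReal.ofReal p) volume ≤ C)
    (hC2 : ∀ n, seminorm (ρn n) p Set.univ (un n) ≤ C) {ε : ℝ≥0∞} (hε : 0 < ε) :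
    ∃ K : EuclideanSpace ℝ (Fin d) → EuclideanSpace ℝ (Fin d) →L[ℝ] EuclideanSpace ℝ (Fin d),
      Integrable K volume ∧ ∃ a : ℝ, ∀ᶠ n in atTop,
        eLpNorm (un n - a • kernelOp K (un n)) (ENNReal.ofReal p) volume ≤ ε := by
  have h0 : 0 < p := by linarith
  obtain ⟨δ, hδ, hW0, hδε⟩ := hsing.exists_pos h0
    (C := d * C) (ENNReal.mul_ne_top (by simp) hC) (ENNReal.half_pos hε.ne')
  set W := ∫⁻ ξ in Metric.ball 0 δ, ENNReal.ofReal (ρ ξ) with hW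
  have hWt : W ≠ ∞ := (setLIntegral_ofReal_ball_lt_top hρ_loc δ).ne
  set B := Metric.ball (0 : EuclideanSpace ℝ (Fin d)) δ with hB
  have hBm : MeasurableSet B := measurableSet_ball
  set w := B.indicator ρ with hw
  have hwi : Integrable w volume := (integrable_indicator_iff hBm).2
    ((hρ_loc.integrableOn_isCompact (isCompact_closedBall 0 δ)).mono_set
      Metric.ball_subset_closedBall)
  have hw0 : ∀ z, 0 ≤ w z := fun z => Set.indicator_nonneg (fun z _ => hρ_nonneg z) z
  have hwrad : ∀ z z' : EuclideanSpace ℝ (Fin d), ‖z‖ = ‖z'‖ → w z = w z' := by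
    intro z z' h
    by_cases hz : z ∈ B
    · have hz' : z' ∈ B := by simpa [hB, ← h] using hz
      simp only [hw, Set.indicator_of_mem hz, Set.indicator_of_mem hz', hρ_rad.1 z z' h]
    · have hz' : z' ∉ B := by simpa [hB, ← h] using hz
      simp only [hw, Set.indicator_of_notMem hz, Set.indicator_of_notMem hz']
  have hwB : ∀ z, ENNReal.ofReal (w z) = B.indicator (fun z => ENNReal.ofReal (ρ z)) z := by
    intro z
    by_cases hz : z ∈ B <;> simp [hw, hz]
  have hwW : ∫⁻ z, ENNReal.ofReal (w z) = W := by
    simp only [hwB]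
    rw [lintegral_indicator hBm]
  set c : ℝ := (∫ z, w z) / Module.finrank ℝ (EuclideanSpace ℝ (Fin d)) with hc
  have hcW : ‖c‖ₑ = W / d := by
    have h1 : ENNReal.ofReal (∫ z, w z) = W := by
      rw [ofReal_integral_eq_lintegral_ofReal hwi (Eventually.of_forall hw0), hwW]
    have hd' : (0 : ℝ) < d := by exact_mod_cast Nat.pos_of_ne_zero (NeZero.ne d)
    rw [Real.enorm_eq_ofReal (div_nonneg (integral_nonneg hw0) (by positivity)),
      finrank_euclideanSpace_fin, ENNReal.ofReal_div_of_pos hd', h1, ENNReal.ofReal_natCast]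
  have hc0 : c ≠ 0 := by
    rw [← enorm_ne_zero, hcW]
    exact ENNReal.div_ne_zero.2 ⟨hW0, by simp⟩
  have hcinv : ‖c⁻¹‖ₑ = d * W⁻¹ := by
    rw [enorm_inv hc0, hcW, ENNReal.inv_div (by simp) (Or.inr hW0), div_eq_mul_inv]
  refine ⟨projKernel w, integrable_projKernel hwi, c⁻¹, ?_⟩
  set T : ℕ → ℝ≥0∞ := fun n =>
    ∫⁻ ξ in B, (ENNReal.ofReal (ρ ξ) - ENNReal.ofReal (ρn n ξ)) with hT
  have hTlim : Tendsto (fun n => d * W⁻¹ * (2 * T n * C)) atTop (𝓝 0) := by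
    have h1 := tendsto_setLIntegral_ofReal_tsub hρ_loc hρn_loc hlim δ
    have h2 := ENNReal.Tendsto.mul_const (b := C)
      (ENNReal.Tendsto.const_mul (a := 2) h1 (Or.inr (by simp))) (Or.inr hC)
    have h3 := ENNReal.Tendsto.const_mul (a := d * W⁻¹) h2
      (Or.inr (ENNReal.mul_ne_top (by simp) (ENNReal.inv_ne_top.2 hW0)))
    simpa using h3
  filter_upwards [hTlim.eventually (gt_mem_nhds (ENNReal.half_pos hε.ne'))] with n hn
  have hTn : ∫⁻ z, (ENNReal.ofReal (w z) - ENNReal.ofReal (ρn n z)) = T n := by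
    rw [hT]
    simp only
    rw [← lintegral_indicator hBm]
    refine lintegral_congr fun z => ?_
    by_cases hz : z ∈ B <;> simp [hw, hz]
  have hEn : (∫⁻ z, min (ENNReal.ofReal (ρn n z)) (ENNReal.ofReal (w z)) *
      ∫⁻ x, ‖(inner ℝ (‖z‖⁻¹ • z) (un n (x + z) - un n x) : ℝ)‖ₑ ^ p) ^ (1 / p)
        ≤ ENNReal.ofReal (δ ^ p) ^ (1 / p) * C := by
    have h1 := lintegral_min_mul_le (w := w) (δ := δ) h0
      (hρn_loc n).aestronglyMeasurable.aemeasurable (hm n)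
      (fun z hz => Set.indicator_of_notMem hz _)
    have h2 := seminorm_rpow_eq (ρ := ρn n) (u := un n) h0 Set.univ
    simp only [Measure.restrict_univ] at h2
    rw [h2] at h1
    refine (ENNReal.rpow_le_rpow h1 (by positivity)).trans ?_
    rw [ENNReal.mul_rpow_of_nonneg _ _ (by positivity), ← ENNReal.rpow_mul,
      mul_one_div_cancel h0.ne', ENNReal.rpow_one]
    gcongr
    exact hC2 n
  have hX := eLpNorm_kernelOp_projKernel_sub_le hp hwi hw0 hwrad
    (hρn_loc n).aestronglyMeasurable.aemeasurable.ennreal_ofReal (hm n) (hup n)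
  rw [hwW, hTn] at hX
  have hsplit : un n - c⁻¹ • kernelOp (projKernel w) (un n)
      = (-c⁻¹) • (kernelOp (projKernel w) (un n) - c • un n) := by
    rw [smul_sub, smul_smul, neg_mul, inv_mul_cancel₀ hc0, neg_smul, neg_smul, one_smul]
    abel
  rw [hsplit, eLpNorm_const_smul, enorm_neg, hcinv]
  -- The `W⁻¹` from dividing by `c` meets Jensen's `W^(1 - 1/p)`, leaving the power that pairs with
  -- `δᵖ`.
  have hWpow : W⁻¹ * W ^ (1 - 1 / p) = (W⁻¹) ^ (1 / p) := by
    rw [← ENNReal.rpow_neg_one, ← ENNReal.rpow_add _ _ hW0 hWt, ← ENNReal.rpow_mul]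
    congr 1
    ring
  calc d * W⁻¹ * eLpNorm (kernelOp (projKernel w) (un n) - c • un n) (ENNReal.ofReal p) volume
      ≤ d * W⁻¹ * (W ^ (1 - 1 / p) * (ENNReal.ofReal (δ ^ p) ^ (1 / p) * C) + 2 * T n * C) := by
        gcongr
        refine hX.trans ?_
        gcongr
        exact hC1 n
    _ = (ENNReal.ofReal (δ ^ p) / W) ^ (1 / p) * (d * C) + d * W⁻¹ * (2 * T n * C) := by
        rw [mul_add]
        congr 1
        rw [div_eq_mul_inv (ENNReal.ofReal (δ ^ p)) W, ENNReal.mul_rpow_of_nonneg _ _ (by positivity), ← hWpow]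
        ring
    _ ≤ ε / 2 + ε / 2 := add_le_add hδε.le hn.le
    _ = ε := ENNReal.add_halves ε

theorem totBddLp_of_bounded_energy [NeZero d] (hp : 1 ≤ p) (hρ_nonneg : ∀ ξ, 0 ≤ ρ ξ)
    (hρ_loc : LocallyIntegrable ρ volume) (hρ_rad : RadialMonotone p ρ)
    (hsing : SufficientlySingular p ρ) (hρn_loc : ∀ n, LocallyIntegrable (ρn n) volume)
    (hlim : ∀ᵐ ξ, ∀ c < ρ ξ, ∀ᶠ n in atTop, c < ρn n ξ)
    (hm : ∀ n, Measurable (un n)) (hup : ∀ n, MemLp (un n) (ENNReal.ofReal p) volume)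
    {C : ℝ≥0∞} (hC : C ≠ ∞) (hC1 : ∀ n, eLpNorm (un n) (ENNReal.ofReal p) volume ≤ C)
    (hC2 : ∀ n, seminorm (ρn n) p Set.univ (un n) ≤ C) (R : ℝ) :
    TotBddLp (ENNReal.ofReal p) (volume.restrict (Metric.closedBall 0 R)) un := by
  have hP : 1 ≤ ENNReal.ofReal p := by simpa using ENNReal.ofReal_le_ofReal hp
  refine TotBddLp.of_approx hP (fun n => (hup n).restrict _) fun ε hε => ?_
  obtain ⟨K, hK, a, ha⟩ := exists_kernel_approx hp hρ_nonneg hρ_loc hρ_rad hsing hρn_loc hlim hm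
    hup hC hC1 hC2 hε
  refine ⟨fun n => a • kernelOp K (un n),
    fun n => ((memLp_kernelOp hp hK (hm n) (hup n)).1.const_smul a).restrict,
    (totBddLp_kernelOp hp hK hm hup hC hC1 R).const_smul a, ?_⟩
  filter_upwards [ha] with n hn
  exact (eLpNorm_mono_measure _ Measure.restrict_le_self).trans hn

/-- Lower semicontinuity of the energies along an `Lᵖ`-convergent sequence. -/
theorem lintegral_energy_le_liminf (hρn_loc : ∀ n, LocallyIntegrable (ρn n) volume) (hp : 1 ≤ p)
    (hlim : ∀ᵐ ξ, ∀ c < ρ ξ, ∀ᶠ n in atTop, c < ρn n ξ) (hm : ∀ n, Measurable (un n))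
    {A : Set (EuclideanSpace ℝ (Fin d))}
    {v : EuclideanSpace ℝ (Fin d) → EuclideanSpace ℝ (Fin d)}
    (hae : ∀ᵐ x ∂volume.restrict A, Tendsto (fun n => un n x) atTop (𝓝 (v x))) :
    ∫⁻ x in A, ∫⁻ y in A, ENNReal.ofReal (ρ (y - x)) * ENNReal.ofReal (|projDiffQuot v x y| ^ p)
      ≤ liminf (fun n => ∫⁻ x in A, ∫⁻ y in A,
        ENNReal.ofReal (ρn n (y - x)) * ENNReal.ofReal (|projDiffQuot (un n) x y| ^ p)) atTop := by
  set μ := volume.restrict A with hμ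
  have hjm : ∀ n, AEMeasurable (fun q : EuclideanSpace ℝ (Fin d) × EuclideanSpace ℝ (Fin d) =>
      ENNReal.ofReal (ρn n (q.2 - q.1)) * ENNReal.ofReal (|projDiffQuot (un n) q.1 q.2| ^ p))
      (μ.prod μ) := by
    intro n
    refine AEMeasurable.mul ?_ (measurable_ofReal_projDiffQuot (hm n) p).aemeasurable
    have h1 : AEMeasurable (fun q : EuclideanSpace ℝ (Fin d) × EuclideanSpace ℝ (Fin d) =>
        ρn n (q.2 - q.1)) (volume.prod volume) :=
      (hρn_loc n).aestronglyMeasurable.aemeasurable.comp_quasiMeasurePreserving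
        ((quasiMeasurePreserving_sub volume volume).comp
          Measure.measurePreserving_swap.quasiMeasurePreserving)
    exact (h1.mono_measure (Measure.prod_mono Measure.restrict_le_self
      Measure.restrict_le_self)).ennreal_ofReal
  have hsm : ∀ n x, AEMeasurable (fun y =>
      ENNReal.ofReal (ρn n (y - x)) * ENNReal.ofReal (|projDiffQuot (un n) x y| ^ p)) μ := by
    intro n x
    refine AEMeasurable.mul ?_
      ((measurable_ofReal_projDiffQuot (hm n) p).comp measurable_prodMk_left).aemeasurable
    have h1 : AEMeasurable (fun y => ρn n (y - x)) volume :=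
      (hρn_loc n).aestronglyMeasurable.aemeasurable.comp_quasiMeasurePreserving
        (measurePreserving_sub_right volume x).quasiMeasurePreserving
    exact h1.ennreal_ofReal.restrict
  refine le_trans ?_ (lintegral_liminf_le' fun n => (hjm n).lintegral_prod_right')
  refine lintegral_mono_ae ?_
  filter_upwards [hae] with x hx
  refine le_trans ?_ (lintegral_liminf_le' fun n => hsm n x)
  refine lintegral_mono_ae ?_
  have hshift : ∀ᵐ y ∂μ, ∀ c < ρ (y - x), ∀ᶠ n in atTop, c < ρn n (y - x) :=
    ae_restrict_of_ae
      ((measurePreserving_sub_right volume x).quasiMeasurePreserving.ae hlim)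
  filter_upwards [hae, hshift] with y hy hxy
  have h1 : Tendsto (fun n => ENNReal.ofReal (|projDiffQuot (un n) x y| ^ p)) atTop
      (𝓝 (ENNReal.ofReal (|projDiffQuot v x y| ^ p))) := by
    refine ENNReal.tendsto_ofReal (Tendsto.rpow_const ?_ (Or.inr (by linarith)))
    refine Tendsto.abs ?_
    exact ((hy.sub hx).const_smul _).inner tendsto_const_nhds
  rw [← h1.liminf_eq]
  exact (mul_le_mul_left (ofReal_le_liminf hxy) _).trans ENNReal.le_liminf_mul

theorem mem_space_of_isLimitPointLp (hρn_loc : ∀ n, LocallyIntegrable (ρn n) volume) (hp : 1 ≤ p)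
    (hlim : ∀ᵐ ξ, ∀ c < ρ ξ, ∀ᶠ n in atTop, c < ρn n ξ) (hm : ∀ n, Measurable (un n))
    {C : ℝ≥0∞} (hC : C ≠ ∞) (hC2 : ∀ n, seminorm (ρn n) p Set.univ (un n) ≤ C)
    {A : Set (EuclideanSpace ℝ (Fin d))}
    {v : EuclideanSpace ℝ (Fin d) → EuclideanSpace ℝ (Fin d)}
    (hv : IsLimitPointLp p A un v) : v ∈ space ρ p A := by
  have h0 : 0 < p := by linarith
  obtain ⟨hvp, φ, hφ, htend⟩ := hv
  refine ⟨hvp, ?_⟩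
  -- Convergence in `Lᵖ` implies convergence in measure, hence almost everywhere along a
  -- subsequence, as Fatou requires.
  obtain ⟨ψ, hψ, hae⟩ := (tendstoInMeasure_of_tendsto_eLpNorm (by simpa using h0)
    (fun n => (hm (φ n)).stronglyMeasurable.aestronglyMeasurable) hvp.1
    htend).exists_seq_tendsto_ae
  have hsub : Tendsto (fun j => φ (ψ j)) atTop atTop :=
    hφ.tendsto_atTop.comp hψ.tendsto_atTop
  have hle := lintegral_energy_le_liminf (ρn := fun j => ρn (φ (ψ j)))
    (un := fun j => un (φ (ψ j))) (fun n => hρn_loc _) hp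
    (hlim.mono fun ξ h c hc => hsub.eventually (h c hc)) (fun n => hm _) hae
  have hbound : ∀ j, ∫⁻ x in A, ∫⁻ y in A, ENNReal.ofReal (ρn (φ (ψ j)) (y - x)) *
      ENNReal.ofReal (|projDiffQuot (un (φ (ψ j))) x y| ^ p) ≤ C ^ p := by
    intro j
    refine le_trans ?_ (ENNReal.rpow_le_rpow (hC2 (φ (ψ j))) h0.le)
    rw [← seminorm_rpow_eq h0]
    refine lintegral_mono' (Measure.restrict_mono (Set.subset_univ _) le_rfl) fun x => ?_
    exact lintegral_mono' (Measure.restrict_mono (Set.subset_univ _) le_rfl) le_rfl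
  have hfin : liminf (fun j => ∫⁻ x in A, ∫⁻ y in A, ENNReal.ofReal (ρn (φ (ψ j)) (y - x)) *
      ENNReal.ofReal (|projDiffQuot (un (φ (ψ j))) x y| ^ p)) atTop ≤ C ^ p :=
    (liminf_le_liminf (Eventually.of_forall hbound)).trans (by simp)
  exact ENNReal.rpow_lt_top_of_nonneg (by positivity)
    ((hle.trans hfin).trans_lt (ENNReal.rpow_lt_top_of_nonneg h0.le hC)).ne

end Compactness

end NonlocalSpace

/-! ### The main theorem -/

open NonlocalSpace

theorem corollary2p4 (d : ℕ) (p : ℝ) (hp : 1 ≤ p)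
    (ρ : EuclideanSpace ℝ (Fin d) → ℝ)
    (hρ_nonneg : ∀ ξ, 0 ≤ ρ ξ)
    (hρ_loc : LocallyIntegrable ρ volume)
    (hρ_rad : NonlocalSpace.RadialMonotone p ρ)
    (hρ_sing : NonlocalSpace.SufficientlySingular p ρ)
    (ρn : ℕ → EuclideanSpace ℝ (Fin d) → ℝ)
    (hρn_nonneg : ∀ n ξ, 0 ≤ ρn n ξ)
    (hρn_loc : ∀ n, LocallyIntegrable (ρn n) volume)
    (hρn_rad : ∀ n, NonlocalSpace.RadialMonotone p (ρn n))
    (hρn_weak : NonlocalSpace.WeakTendstoL1Loc ρn ρ)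
    (u : ℕ → EuclideanSpace ℝ (Fin d) → EuclideanSpace ℝ (Fin d))
    (hu : ∀ n, MemLp (u n) (ENNReal.ofReal p) volume)
    (hu_bdd : ⨆ n, (eLpNorm (u n) (ENNReal.ofReal p) volume +
      NonlocalSpace.seminorm (ρn n) p Set.univ (u n)) < ∞) :
    NonlocalSpace.PrecompactLpLoc p u ∧
    ∀ A : Set (EuclideanSpace ℝ (Fin d)), Bornology.IsBounded A →
      ∀ v : EuclideanSpace ℝ (Fin d) → EuclideanSpace ℝ (Fin d),
        NonlocalSpace.IsLimitPointLp p A u v → v ∈ NonlocalSpace.space ρ p A := by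
  have h0 : 0 < p := by linarith
  -- In dimension `0` all fields vanish; the main argument needs unit vectors and division by `d`.
  rcases eq_or_ne d 0 with rfl | hd
  · refine ⟨fun φ _ => ⟨id, strictMono_id, 0, fun K _ => ⟨MemLp.zero, ?_⟩⟩, fun A _ v hv =>
      ⟨hv.1, ?_⟩⟩
    · have h : ∀ j, u (φ (id j)) - 0 = 0 := fun j => Subsingleton.elim _ _
      simp only [TendstoLp, h]
      simp
    · have h : ∀ x y, projDiffQuot v x y = 0 := fun x y => by
        rw [projDiffQuot, Subsingleton.elim (y - x) 0, smul_zero, inner_zero_right]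
      simp [seminorm, h, h0.ne', h0]
  have : NeZero d := ⟨hd⟩
  set C := ⨆ n, (eLpNorm (u n) (ENNReal.ofReal p) volume + seminorm (ρn n) p Set.univ (u n))
    with hCdef
  have hC : C ≠ ∞ := hu_bdd.ne
  have hCn : ∀ n, eLpNorm (u n) (ENNReal.ofReal p) volume + seminorm (ρn n) p Set.univ (u n) ≤ C :=
    fun n => le_iSup (fun n => eLpNorm (u n) (ENNReal.ofReal p) volume +
      seminorm (ρn n) p Set.univ (u n)) n
  have hlim := hρn_weak.ae_eventually_lt h0.le hρ_loc hρ_rad hρn_nonneg hρn_rad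
  -- Measurable representatives; norms and seminorms do not change.
  set w : ℕ → EuclideanSpace ℝ (Fin d) → EuclideanSpace ℝ (Fin d) :=
    fun n => (hu n).1.mk (u n) with hw
  have hwu : ∀ n, u n =ᵐ[volume] w n := fun n => (hu n).1.ae_eq_mk
  have hwm : ∀ n, Measurable (w n) := fun n => (hu n).1.stronglyMeasurable_mk.measurable
  have hwp : ∀ n, MemLp (w n) (ENNReal.ofReal p) volume := fun n =>
    (memLp_congr_ae (hwu n)).1 (hu n)
  have hC1 : ∀ n, eLpNorm (w n) (ENNReal.ofReal p) volume ≤ C := fun n =>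
    (eLpNorm_congr_ae (hwu n)).symm.trans_le (le_self_add.trans (hCn n))
  have hC2 : ∀ n, seminorm (ρn n) p Set.univ (w n) ≤ C := fun n =>
    (seminorm_congr_ae (ae_restrict_of_ae (hwu n))).symm.trans_le (le_add_self.trans (hCn n))
  have hLp : ∀ (n : ℕ) (A : Set (EuclideanSpace ℝ (Fin d)))
      (v : EuclideanSpace ℝ (Fin d) → EuclideanSpace ℝ (Fin d)),
      eLpNorm (w n - v) (ENNReal.ofReal p) (volume.restrict A)
        = eLpNorm (u n - v) (ENNReal.ofReal p) (volume.restrict A) := by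
    intro n A v
    have h : w n =ᵐ[volume.restrict A] u n := ae_restrict_of_ae (hwu n).symm
    exact eLpNorm_congr_ae (h.sub (ae_eq_refl v))
  constructor
  · intro φ _
    obtain ⟨ψ, hψ, v, hv⟩ := exists_subseq_tendsto hp (fun n => hwp (φ n)) hC (fun n => hC1 (φ n))
      fun R => (totBddLp_of_bounded_energy hp hρ_nonneg hρ_loc hρ_rad hρ_sing hρn_loc hlim hwm hwp
        hC hC1 hC2 R).comp φ
    refine ⟨ψ, hψ, v, fun K hK => ⟨(hv K hK).1, ?_⟩⟩
    simpa only [TendstoLp, hLp] using (hv K hK).2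
  · rintro A - v ⟨hv, φ, hφ, htend⟩
    refine mem_space_of_isLimitPointLp hρn_loc hp hlim hwm hC hC2 ⟨hv, φ, hφ, ?_⟩
    simpa only [TendstoLp, hLp] using htend
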